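/- Let $k$ be a field, let $q\in k$ be nonzero, and let $1\le m\le n$ be integers. Let $\mathcal{O}_q(M_{mn})$ be the $k$-algebra generated by $X_{ij}$ ($1\le i\le m$, $1\le j\le n$) subject to the relations $$X_{ij}X_{il}=qX_{il}X_{ij}\quad(j<l),\qquad X_{ij}X_{i'j}=qX_{i'j}X_{ij}\quad(i<i'),$$ $$X_{il}X_{i'j}=X_{i'j}X_{il},\qquad X_{ij}X_{i'l}-X_{i'l}X_{ij}=(q-q^{-1})X_{il}X_{i'j}\quad(i<i',\ j<l).$$ For $J=\{j_1<\dots<j_m\}\subseteq\{1,\dots,n\}$ let $[J]=\sum_{\sigma\in S_m}(-q)^{\ell(\sigma)}X_{1,j_{\sigma(1)}}\cdots X_{m,j_{\sigma(m)}}$ be the corresponding maximal quantum minor, where $\ell(\sigma)$ is the number of inversions of $\sigma$, and let $\mathcal{G}_q(m,n)$ be the subalgebra of $\mathcal{O}_q(M_{mn})$ generated by all the $[J]$. It carries the $\mathbb{Z}^n$-grading induced from the grading of $\mathcal{O}_q(M_{mn})$ in which $X_{ij}$ has degree $\varepsilon_j$, the $j$-th standard basis vector. For $m$-element subsets $A=\{a_1<\dots<a_m\}$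 and $B=\{b_1<\dots<b_m\}$ of $\{1,\dots,n\}$, write $A\le_* B$ if $a_i\le b_i$ for all $i$. A preferred $m$-tableau is a finite (possibly empty) sequence $T=(J_1,\dots,J_s)$ of $m$-element subsets of $\{1,\dots,n\}$ with $J_1\le_* J_2\le_*\dots\le_* J_s$; put $[T]=[J_1][J_2]\cdots[J_s]$, with $[T]=1$ if $s=0$. The content of $T$ is the multiset $(1^{t_1}2^{t_2}\cdots n^{t_n})$, where $t_j$ is the number of indices $r$ with $j\in J_r$. (a) Let $\delta=(c_1,\dots,c_n)\in\mathbb{N}^n$, where $\mathbb N$ includes $0$, and let $V$ be the homogeneous component of $\mathcal{G}_q(m,n)$ of degree $\delta$. Then the products $[T]$, as $T$ runs over all preferred $m$-tableaux with content $(1^{c_1}2^{c_2}\cdots n^{c_n})$, form a $k$-basis of $V$. (b) The products $[T]$, as $T$ runs over all preferred $m$-tableaux, form a $k$-basis of $\mathcal{G}_q(m,n)$. -/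

import Mathlib

namespace QuantumGrassmannian

/-- The defining relations of the algebra of quantum `m × n` matrices, imposed on the free
algebra on letters `X_{ij}`; rows and columns are numbered from `0`. -/
inductive MatrixRel {k : Type*} [Field k] (q : k) (m n : ℕ) :
    FreeAlgebra k (Fin m × Fin n) → FreeAlgebra k (Fin m × Fin n) → Prop
  | row (i : Fin m) (j l : Fin n) (hjl : j < l) :
      MatrixRel q m n
        (FreeAlgebra.ι k (i, j) * FreeAlgebra.ι k (i, l))
        (q • (FreeAlgebra.ι k (i, l) * FreeAlgebra.ι k (i, j)))
  | col (i i' : Fin m) (j : Fin n) (hi : i < i') :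
      MatrixRel q m n
        (FreeAlgebra.ι k (i, j) * FreeAlgebra.ι k (i', j))
        (q • (FreeAlgebra.ι k (i', j) * FreeAlgebra.ι k (i, j)))
  | anti (i i' : Fin m) (j l : Fin n) (hi : i < i') (hjl : j < l) :
      MatrixRel q m n
        (FreeAlgebra.ι k (i, l) * FreeAlgebra.ι k (i', j))
        (FreeAlgebra.ι k (i', j) * FreeAlgebra.ι k (i, l))
  | diag (i i' : Fin m) (j l : Fin n) (hi : i < i') (hjl : j < l) :
      MatrixRel q m n
        (FreeAlgebra.ι k (i, j) * FreeAlgebra.ι k (i', l)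
          - FreeAlgebra.ι k (i', l) * FreeAlgebra.ι k (i, j))
        ((q - q⁻¹) • (FreeAlgebra.ι k (i, l) * FreeAlgebra.ι k (i', j)))

/-- The coordinate ring `O_q(M_{mn})` of quantum `m × n` matrices over `k`. -/
def QMatrix {k : Type*} [Field k] (q : k) (m n : ℕ) : Type _ :=
  RingQuot (MatrixRel q m n)

noncomputable instance {k : Type*} [Field k] (q : k) (m n : ℕ) : Ring (QMatrix q m n) :=
  inferInstanceAs (Ring (RingQuot (MatrixRel q m n)))

noncomputable instance {k : Type*} [Field k] (q : k) (m n : ℕ) : Algebra k (QMatrix q m n) :=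
  inferInstanceAs (Algebra k (RingQuot (MatrixRel q m n)))

/-- The quotient map from the free algebra onto `O_q(M_{mn})`. -/
noncomputable def QMatrix.mk {k : Type*} [Field k] (q : k) (m n : ℕ) :
    FreeAlgebra k (Fin m × Fin n) →ₐ[k] QMatrix q m n :=
  RingQuot.mkAlgHom k (MatrixRel q m n)

/-- The canonical generator `X_{ij}` of `O_q(M_{mn})`. -/
noncomputable def X {k : Type*} [Field k] (q : k) {m n : ℕ} (i : Fin m) (j : Fin n) :
    QMatrix q m n :=
  QMatrix.mk q m n (FreeAlgebra.ι k (i, j))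

/-- The length `ℓ(σ)` of a permutation, as its number of inversions. -/
def invCount {s : ℕ} (σ : Equiv.Perm (Fin s)) : ℕ :=
  (Finset.univ.filter fun p : Fin s × Fin s => p.1 < p.2 ∧ σ p.2 < σ p.1).card

/-- The quantum minor `[I | J]`.  An `s`-element index set is represented by its increasing
enumeration. -/
noncomputable def quantumMinor {k : Type*} [Field k] (q : k) {m n s : ℕ}
    (I : Fin s ↪o Fin m) (J : Fin s ↪o Fin n) : QMatrix q m n :=
  ∑ σ : Equiv.Perm (Fin s),
    (-q) ^ invCount σ • (List.ofFn fun a : Fin s => X q (I a) (J (σ a))).prod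

/-- The maximal quantum minor `[J]`, which uses all the rows and the columns in `J`. -/
noncomputable def maxMinor {k : Type*} [Field k] (q : k) {m n : ℕ}
    (J : Fin m ↪o Fin n) : QMatrix q m n :=
  quantumMinor q (RelEmbedding.refl (· ≤ ·)) J

/-- The quantum grassmannian `G_q(m,n)`: the subalgebra of `O_q(M_{mn})` generated by the
maximal quantum minors. -/
noncomputable def grassmannian {k : Type*} [Field k] (q : k) (m n : ℕ) :
    Subalgebra k (QMatrix q m n) :=
  Algebra.adjoin k (Set.range fun J : Fin m ↪o Fin n => maxMinor q J)

/-- The maximal quantum minor `[J]`, as an element of `G_q(m,n)`. -/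
noncomputable def gMinor {k : Type*} [Field k] (q : k) {m n : ℕ}
    (J : Fin m ↪o Fin n) : grassmannian q m n :=
  ⟨maxMinor q J, Algebra.subset_adjoin ⟨J, rfl⟩⟩

/-- The degree in `ℤ^n` of a word in the generators, where `X_{ij}` has degree `ε_j`. -/
def wordDegree {m n : ℕ} (w : List (Fin m × Fin n)) : Fin n → ℤ :=
  (w.map fun p => Pi.single p.2 1).sum

/-- The homogeneous component of degree `d` of `O_q(M_{mn})`: the span of the monomials in the
generators that have degree `d`. -/
noncomputable def matrixComponent {k : Type*} [Field k] (q : k) (m n : ℕ) (d : Fin n → ℤ) :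
    Submodule k (QMatrix q m n) :=
  Submodule.span k
    ((fun w : List (Fin m × Fin n) => (w.map fun p => X q p.1 p.2).prod) ''
      {w | wordDegree w = d})

/-- The homogeneous component of degree `d` of `G_q(m,n)` for the grading induced from
`O_q(M_{mn})`. -/
noncomputable def grassmannianComponent {k : Type*} [Field k] (q : k) (m n : ℕ)
    (d : Fin n → ℤ) : Submodule k (grassmannian q m n) :=
  (matrixComponent q m n d).comap (grassmannian q m n).val.toLinearMap

/-- An allowable `m`-tableau with entries in an `n`-element set: a finite list of strictly
increasing rows of length `m`. -/
abbrev Tableau (m n : ℕ) : Type := List (Fin m ↪o Fin n)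

/-- The order `≤_*` on `m`-element subsets: entrywise comparison of increasing enumerations. -/
def StarLE {m n : ℕ} (A B : Fin m ↪o Fin n) : Prop := ∀ a : Fin m, A a ≤ B a

/-- `T` is preferred if its rows satisfy `J_1 ≤_* J_2 ≤_* … ≤_* J_s`. -/
def Tableau.Preferred {m n : ℕ} (T : Tableau m n) : Prop := List.IsChain StarLE T

/-- The content of a tableau: the multiset of its entries. -/
def Tableau.content {m n : ℕ} (T : Tableau m n) : Multiset (Fin n) :=
  (T.map fun J : Fin m ↪o Fin n => (Finset.univ : Finset (Fin m)).val.map J).sum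

/-- The multiset `(1^{c_1} 2^{c_2} ⋯ n^{c_n})`. -/
def multisetOf {n : ℕ} (c : Fin n → ℕ) : Multiset (Fin n) :=
  ∑ j, Multiset.replicate (c j) j

/-- The product `[T] = [J_1][J_2]⋯[J_s]` in `G_q(m,n)` given by a tableau. -/
noncomputable def tableauProduct {k : Type*} [Field k] (q : k) {m n : ℕ}
    (T : Tableau m n) : grassmannian q m n :=
  (T.map fun J => gMinor q J).prod

end QuantumGrassmannian

/-! Spanning is a straightening argument. A row of a quantum matrix defines a vector in a quantum
exterior algebra; the vectors of distinct rows commute up to a nonzero scalar and each squares to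
zero. Minors are coordinates of products of such vectors, and associativity of these products is
Laplace expansion (`wedgeList_eq_sum`). Expanding two maximal minors in this way and summing over
the splittings of more than `m` columns produces a wedge of rows that must vanish: this is
`IsQMat.exchange`. When `B i < A i`, the relation rewrites `[A][B]` through products whose first row
has smaller entry sum and whose total sum is the same (`maxMinor_mul_mem_span`). A weighted sum of
the entries drops, so rewriting terminates at preferred tableaux.

Independence comes from a representation of `O_q(M_{mn})` by weighted shifts on a space with a basis
of monomials. A product of quantum matrices with mutually commuting entries is again a quantum
matrix (`IsRTT.mul`). So elementary upper triangular matrices `cell`, each on its own group of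
variables, may be multiplied together, along with a diagonal matrix of variables recording columns.
Giving group `p` weight `p`, each entry in the upper triangle of the first `m` rows has a single
leading shift with nonzero coefficients (`pathOp_lead`). By the rearrangement inequality only the
identity permutation contributes to the leading part of a maximal minor, hence `[T]` has a leading
monomial. That monomial determines a preferred `T` (`tableauExpo_injective`), so the vectors
obtained from the vacuum are independent.

This gives (b). The recorded columns separate multidegrees in the model. As the model is faithful on
the span of the basis, a homogeneous element involves only the tableaux of its own content, which
gives (a). -/

namespace QuantumGrassmannian

open Finset

/-! ### Quantum matrices in an arbitrary algebra -/

section IsQMat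

variable {k : Type*} [Field k] {ι κ A : Type*} [LinearOrder ι] [LinearOrder κ]
  [Ring A] [Algebra k A]

/-- A matrix with entries in a `k`-algebra that satisfies the relations of quantum matrices. -/
structure IsQMat (q : k) (x : ι → κ → A) : Prop where
  row : ∀ i j l, j < l → x i j * x i l = q • (x i l * x i j)
  col : ∀ i i' j, i < i' → x i j * x i' j = q • (x i' j * x i j)
  anti : ∀ i i' j l, i < i' → j < l → x i l * x i' j = x i' j * x i l
  diag : ∀ i i' j l, i < i' → j < l →
    x i j * x i' l - x i' l * x i j = (q - q⁻¹) • (x i l * x i' j)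

theorem IsQMat.transpose {q : k} {x : ι → κ → A} (h : IsQMat q x) :
    IsQMat q (fun j i => x i j) where
  row i j l hjl := h.col j l i hjl
  col i i' j hi := h.row j i i' hi
  anti i i' j l hi hj := (h.anti j l i i' hj hi).symm
  diag i i' j l hi hj := by rw [h.diag j l i i' hj hi, h.anti j l i i' hj hi]

end IsQMat

theorem QMatrix.mk_eq_of_rel {k : Type*} [Field k] {q : k} {m n : ℕ}
    {a b : FreeAlgebra k (Fin m × Fin n)} (h : MatrixRel q m n a b) :
    QMatrix.mk q m n a = QMatrix.mk q m n b :=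
  RingQuot.mkAlgHom_rel k h

theorem isQMat_X {k : Type*} [Field k] (q : k) (m n : ℕ) :
    IsQMat q (fun (i : Fin m) (j : Fin n) => X q i j) where
  row i j l h := by
    simpa only [X, map_mul, map_smul] using QMatrix.mk_eq_of_rel (.row (q := q) i j l h)
  col i i' j h := by
    simpa only [X, map_mul, map_smul] using QMatrix.mk_eq_of_rel (.col (q := q) i i' j h)
  anti i i' j l h h' := by
    simpa only [X, map_mul, map_smul] using QMatrix.mk_eq_of_rel (.anti (q := q) i i' j l h h')
  diag i i' j l h h' := by
    simpa only [X, map_mul, map_smul, map_sub] using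
      QMatrix.mk_eq_of_rel (.diag (q := q) i i' j l h h')

/-! ### The quantum exterior algebra and Laplace expansion -/

section Wedge

variable {k : Type*} [Field k] {ι κ A : Type*} [LinearOrder ι] [LinearOrder κ]
  [Ring A] [Algebra k A]

/-- The number of elements of `T` below `j`. -/
def below (T : Finset ι) (j : ι) : ℕ := #{t ∈ T | t < j}

theorem below_erase_of_lt {T : Finset ι} {j l : ι} (h : j < l) :
    below (T.erase l) j = below T j := by
  unfold below
  congr 1
  ext t
  simp only [mem_filter, mem_erase]
  constructor
  · rintro ⟨⟨_, h1⟩, h2⟩; exact ⟨h1, h2⟩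
  · rintro ⟨h1, h2⟩; exact ⟨⟨(h2.trans h).ne, h1⟩, h2⟩

theorem below_erase_add_one {T : Finset ι} {j l : ι} (hj : j ∈ T) (h : j < l) :
    below (T.erase j) l + 1 = below T l := by
  unfold below
  rw [filter_erase, card_erase_add_one]
  simp [hj, h]

theorem below_union {P Q : Finset ι} (h : Disjoint P Q) (j : ι) :
    below (P ∪ Q) j = below P j + below Q j := by
  unfold below
  rw [filter_union, card_union_of_disjoint]
  exact disjoint_filter_filter h

/-- Left multiplication by `∑ j, x j ξ j` on the quantum exterior algebra with coefficients
in `A`, in coordinates with respect to the basis of ordered products of the `ξ j`. -/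
def wedge (q : k) (x : ι → A) : (Finset ι → A) →ₗ[k] (Finset ι → A) where
  toFun g T := ∑ j ∈ T, (-q) ^ below T j • (x j * g (T.erase j))
  map_add' g g' := by
    ext T
    simp [mul_add, sum_add_distrib]
  map_smul' c g := by
    ext T
    simp [smul_sum, smul_comm c]

theorem wedge_apply (q : k) (x : ι → A) (g : Finset ι → A) (T : Finset ι) :
    wedge q x g T = ∑ j ∈ T, (-q) ^ below T j • (x j * g (T.erase j)) := rfl

/-- The relation `ξ_l ξ_j = -q ξ_j ξ_l` for `j < l` collects the terms in pairs, so a product of two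
vectors depends only on their quantum `2 × 2` minors. -/
theorem wedge_wedge (q : k) (x x' : ι → A) (g : Finset ι → A) (T : Finset ι) :
    wedge q x (wedge q x' g) T = ∑ j ∈ T, ∑ l ∈ T, if j < l then
      (-q) ^ (below T j + below (T.erase j) l) •
        ((x j * x' l - q • (x l * x' j)) * g ((T.erase j).erase l)) else 0 := by
  have h1 : wedge q x (wedge q x' g) T = ∑ j ∈ T, ((∑ l ∈ T, if j < l then
      (-q) ^ (below T j + below (T.erase j) l) • (x j * x' l * g ((T.erase j).erase l)) else 0)
      + ∑ l ∈ T, if l < j then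
      (-q) ^ (below T j + below (T.erase j) l) •
        (x j * x' l * g ((T.erase j).erase l)) else 0) := by
    rw [wedge_apply]
    refine sum_congr rfl fun j hj => ?_
    rw [wedge_apply, mul_sum, smul_sum, ← sum_add_distrib, ← sum_erase_add T _ hj]
    simp only [lt_irrefl, if_false, add_zero]
    refine sum_congr rfl fun l hl => ?_
    have hne := (mem_erase.1 hl).1
    rcases lt_or_gt_of_ne hne with h | h
    · rw [if_neg h.not_gt, if_pos h, zero_add, pow_add, mul_smul, mul_smul_comm, mul_assoc]
    · rw [if_pos h, if_neg h.not_gt, add_zero, pow_add, mul_smul, mul_smul_comm, mul_assoc]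
  rw [h1, sum_add_distrib]
  rw [sum_comm (s := T) (t := T) (f := fun j l => if l < j then _ else _), ← sum_add_distrib]
  refine sum_congr rfl fun j hj => ?_
  rw [← sum_add_distrib]
  refine sum_congr rfl fun l hl => ?_
  split_ifs with h
  · rw [below_erase_of_lt h, ← below_erase_add_one hj h, erase_right_comm (a := l), sub_mul,
      smul_sub, sub_eq_add_neg]
    congr 1
    rw [smul_mul_assoc, smul_smul, ← neg_smul]
    congr 1
    ring
  · simp

variable {q : k}

theorem IsQMat.wedge_self {x : ι → κ → A} (h : IsQMat q x) (i : ι) (g : Finset κ → A) :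
    wedge q (x i) (wedge q (x i) g) = 0 := by
  ext T
  rw [wedge_wedge]
  refine sum_eq_zero fun j _ => sum_eq_zero fun l _ => ?_
  split_ifs with hjl
  · rw [h.row i j l hjl, sub_self, zero_mul, smul_zero]
  · rfl

/-- By `wedge_wedge` this is an identity between `2 × 2` minors with the two rows interchanged; it
follows from the relations `anti` and `diag`. -/
theorem IsQMat.wedge_comm (hq : q ≠ 0) {x : ι → κ → A} (h : IsQMat q x) {i i' : ι}
    (hi : i < i') (g : Finset κ → A) :
    wedge q (x i') (wedge q (x i) g) = -q • wedge q (x i) (wedge q (x i') g) := by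
  ext T
  rw [Pi.smul_apply, wedge_wedge, wedge_wedge, smul_sum]
  refine sum_congr rfl fun j _ => ?_
  rw [smul_sum]
  refine sum_congr rfl fun l _ => ?_
  split_ifs with hjl
  · rw [smul_comm (-q), ← smul_mul_assoc (-q)]
    congr 2
    have h1 := h.anti i i' j l hi hjl
    have h2 := h.diag i i' j l hi hjl
    rw [sub_eq_iff_eq_add] at h2
    rw [h2, ← h1]
    have : q * q⁻¹ = 1 := mul_inv_cancel₀ hq
    simp only [smul_sub, smul_add, smul_smul, neg_mul, neg_smul, this, sub_smul, one_smul]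
    abel
  · simp

theorem IsQMat.exists_wedge_comm (hq : q ≠ 0) {x : ι → κ → A} (h : IsQMat q x) (i i' : ι) :
    ∃ s : k, s ≠ 0 ∧ ∀ g : Finset κ → A,
      wedge q (x i) (wedge q (x i') g) = s • wedge q (x i') (wedge q (x i) g) := by
  rcases lt_trichotomy i i' with hi | hi | hi
  · refine ⟨-q⁻¹, by simpa, fun g => ?_⟩
    rw [h.wedge_comm hq hi, smul_smul]
    simp [hq]
  · exact ⟨1, one_ne_zero, fun g => by rw [hi, one_smul]⟩
  · exact ⟨-q, by simpa, fun g => h.wedge_comm hq hi g⟩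

/-- The iterated product of `wedge` along a list of vectors. -/
def wedgeList (q : k) (xs : List (ι → A)) (g : Finset ι → A) : Finset ι → A :=
  xs.foldr (fun x => wedge q x) g

@[simp] theorem wedgeList_nil (g : Finset ι → A) : wedgeList q [] g = g := rfl

@[simp] theorem wedgeList_cons (x : ι → A) (xs : List (ι → A)) (g : Finset ι → A) :
    wedgeList q (x :: xs) g = wedge q x (wedgeList q xs g) := rfl

theorem wedgeList_append (xs ys : List (ι → A)) (g : Finset ι → A) :
    wedgeList q (xs ++ ys) g = wedgeList q xs (wedgeList q ys g) := by
  simp [wedgeList, List.foldr_append]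

theorem IsQMat.exists_wedgeList_perm (hq : q ≠ 0) {x : ι → κ → A} (h : IsQMat q x)
    {l l' : List ι} (hl : l.Perm l') :
    ∃ s : k, s ≠ 0 ∧ ∀ g : Finset κ → A,
      wedgeList q (l.map x) g = s • wedgeList q (l'.map x) g := by
  induction hl with
  | nil => exact ⟨1, one_ne_zero, fun g => by simp⟩
  | cons a _ ih =>
    obtain ⟨s, hs, ih⟩ := ih
    exact ⟨s, hs, fun g => by simp [ih]⟩
  | swap a b l =>
    obtain ⟨s, hs, hc⟩ := h.exists_wedge_comm hq b a
    exact ⟨s, hs, fun g => by simp [hc]⟩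
  | trans _ _ ih1 ih2 =>
    obtain ⟨s, hs, h1⟩ := ih1
    obtain ⟨t, ht, h2⟩ := ih2
    exact ⟨s * t, mul_ne_zero hs ht, fun g => by rw [h1, h2, smul_smul]⟩

theorem IsQMat.wedge_wedgeList_of_mem (hq : q ≠ 0) {x : ι → κ → A} (h : IsQMat q x)
    {i : ι} {l : List ι} (hi : i ∈ l) (g : Finset κ → A) :
    wedge q (x i) (wedgeList q (l.map x) g) = 0 := by
  induction l with
  | nil => simp at hi
  | cons a l ih =>
    rw [List.map_cons, wedgeList_cons]
    rcases List.mem_cons.1 hi with rfl | hi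
    · exact h.wedge_self _ _
    · obtain ⟨s, _, hc⟩ := h.exists_wedge_comm hq i a
      rw [hc, ih hi, map_zero, smul_zero]

theorem IsQMat.wedgeList_of_not_nodup (hq : q ≠ 0) {x : ι → κ → A} (h : IsQMat q x)
    {l : List ι} (hl : ¬ l.Nodup) (g : Finset κ → A) :
    wedgeList q (l.map x) g = 0 := by
  induction l with
  | nil => simp at hl
  | cons a l ih =>
    rw [List.map_cons, wedgeList_cons]
    by_cases ha : a ∈ l
    · exact h.wedge_wedgeList_of_mem hq ha g
    · rw [ih (fun hn => hl (List.nodup_cons.2 ⟨ha, hn⟩)), map_zero]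

/-- The unit of the quantum exterior algebra. -/
def vac (ι A : Type*) [DecidableEq ι] [Ring A] : Finset ι → A := fun T => if T = ∅ then 1 else 0

theorem wedgeList_vac_of_card_ne (xs : List (ι → A)) {T : Finset ι} (h : #T ≠ xs.length) :
    wedgeList q xs (vac ι A) T = 0 := by
  induction xs generalizing T with
  | nil =>
    have : T ≠ ∅ := by rintro rfl; simp at h
    simp [vac, this]
  | cons x xs ih =>
    rw [wedgeList_cons, wedge_apply]
    refine sum_eq_zero fun j hj => ?_
    rw [ih, mul_zero, smul_zero]
    rw [card_erase_of_mem hj]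
    have := card_pos.2 ⟨j, hj⟩
    simp at h
    omega

/-- The number of inversions between `P` and `Q`. -/
def crossings (P Q : Finset ι) : ℕ := ∑ p ∈ P, below Q p

/-- Laplace expansion: wedging with `xs` is left multiplication by the element that `xs` produces
from the unit, and `(-q) ^ crossings` is the cost of sorting `P` followed by `K \ P`. -/
theorem wedgeList_eq_sum (xs : List (ι → A)) (g : Finset ι → A) (K : Finset ι) :
    wedgeList q xs g K = ∑ P ∈ K.powerset,
      (-q) ^ crossings P (K \ P) • (wedgeList q xs (vac ι A) P * g (K \ P)) := by
  induction xs generalizing K with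
  | nil =>
    rw [sum_eq_single ∅]
    · simp [vac, crossings]
    · intro P _ hP
      simp [vac, hP]
    · simp
  | cons x xs ih =>
    simp only [wedgeList_cons, wedge_apply]
    simp only [ih, mul_sum, smul_sum, sum_mul]
    rw [sum_sigma', sum_sigma']
    -- One side removes `j` from `K` and then chooses `P`; the other chooses the larger part `insert
    -- j P` and then removes `j` from it.
    refine sum_bij' (fun a _ => ⟨insert a.1 a.2, a.1⟩) (fun a _ => ⟨a.2, a.1.erase a.2⟩)
      ?_ ?_ ?_ ?_ ?_
    · rintro ⟨j, P⟩ h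
      simp only [mem_sigma, mem_powerset] at h ⊢
      exact ⟨insert_subset h.1 (h.2.trans (erase_subset _ _)), mem_insert_self _ _⟩
    · rintro ⟨P, j⟩ h
      simp only [mem_sigma, mem_powerset] at h ⊢
      exact ⟨h.1 h.2, erase_subset_erase _ h.1⟩
    · rintro ⟨j, P⟩ h
      simp only [mem_sigma, mem_powerset] at h
      have : j ∉ P := fun hj => by simpa using h.2 hj
      simp [this]
    · rintro ⟨P, j⟩ h
      simp only [mem_sigma, mem_powerset] at h
      simp [h.2]
    · rintro ⟨j, P⟩ h
      simp only [mem_sigma, mem_powerset] at h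
      have hj : j ∉ P := fun hj => by simpa using h.2 hj
      have hK : K.erase j \ P = K \ insert j P := by
        ext t; simp only [mem_sdiff, mem_erase, mem_insert]; tauto
      have hb : below K j = below (insert j P) j + below (K \ insert j P) j := by
        rw [← below_union disjoint_sdiff, union_sdiff_of_subset]
        exact insert_subset h.1 (h.2.trans (erase_subset _ _))
      simp only [erase_insert hj, hK, crossings, sum_insert hj, hb]
      simp only [mul_smul_comm, smul_mul_assoc, smul_smul, ← pow_add, mul_assoc]
      congr 2
      ring

end Wedge

/-! ### Row and column expansions of minors -/

section Minor

variable {k : Type*} [Field k] {ι κ A : Type*} [LinearOrder ι] [LinearOrder κ]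
  [Ring A] [Algebra k A] {q : k}

/-- The minor of `x` with rows `I` and columns `J`, expanded along rows. -/
def rowMinor (q : k) (x : ι → κ → A) (I : Finset ι) (J : Finset κ) : A :=
  wedgeList q ((I.sort (· ≤ ·)).map x) (vac κ A) J

theorem sort_insert_of_lt {I : Finset ι} {i : ι} (h : ∀ a ∈ I, i < a) :
    (insert i I).sort (· ≤ ·) = i :: I.sort (· ≤ ·) :=
  sort_insert (r := (· ≤ ·)) (fun a ha => (h a ha).le) (fun hi => lt_irrefl _ (h i hi))

theorem rowMinor_insert (x : ι → κ → A) {I : Finset ι} {i : ι} (h : ∀ a ∈ I, i < a)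
    (J : Finset κ) :
    rowMinor q x (insert i I) J =
      ∑ j ∈ J, (-q) ^ below J j • (x i j * rowMinor q x I (J.erase j)) := by
  rw [rowMinor, sort_insert_of_lt h]
  rfl

theorem rowMinor_empty_left (x : ι → κ → A) (J : Finset κ) :
    rowMinor q x ∅ J = if J = ∅ then 1 else 0 := by
  simp [rowMinor, vac]

theorem exists_insert_min {I : Finset ι} (h : I.Nonempty) :
    ∃ (i : ι) (I' : Finset ι), (∀ a ∈ I', i < a) ∧ i ∉ I' ∧ insert i I' = I := by
  refine ⟨I.min' h, I.erase (I.min' h), fun a ha => ?_, by simp, insert_erase (min'_mem _ _)⟩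
  exact min'_lt_of_mem_erase_min' _ _ ha

theorem rowMinor_empty_right (x : ι → κ → A) (I : Finset ι) :
    rowMinor q x I ∅ = if I = ∅ then 1 else 0 := by
  rcases I.eq_empty_or_nonempty with rfl | h
  · simp [rowMinor_empty_left]
  · obtain ⟨i, I', h1, _, rfl⟩ := exists_insert_min h
    rw [rowMinor_insert x h1]
    simp

theorem below_insert_of_lt {J : Finset κ} {j l : κ} (hj : j ∉ J) (h : j < l) :
    below (insert j J) l = below J l + 1 := by
  rw [← below_erase_add_one (mem_insert_self j J) h, erase_insert hj]

theorem below_eq_zero {J : Finset κ} {j : κ} (h : ∀ a ∈ J, j ≤ a) : below J j = 0 := by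
  unfold below
  rw [card_eq_zero, filter_eq_empty_iff]
  exact fun a ha => (h a ha).not_gt

theorem below_insert_self {J : Finset κ} {j : κ} (h : ∀ a ∈ J, j < a) :
    below (insert j J) j = 0 := by
  refine below_eq_zero fun b hb => ?_
  rcases mem_insert.1 hb with rfl | hb
  · exact le_rfl
  · exact (h b hb).le

/-- Both sides expand along the first row and the first column. The corner terms agree by induction;
the rest are double sums over `x i l * x i' j`, whose order is reversed by `anti`. Thus row and
column Laplace expansions can be used together. -/
theorem IsQMat.rowMinor_transpose {x : ι → κ → A} (h : IsQMat q x) (I : Finset ι)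
    (J : Finset κ) : rowMinor q x I J = rowMinor q (fun j i => x i j) J I := by
  induction hN : #I using Nat.strong_induction_on generalizing I J with
  | _ N ih =>
  rcases I.eq_empty_or_nonempty with rfl | hI
  · rw [rowMinor_empty_left, rowMinor_empty_right]
  rcases J.eq_empty_or_nonempty with rfl | hJ
  · rw [rowMinor_empty_left, rowMinor_empty_right]
  obtain ⟨i, I', hi, hi', rfl⟩ := exists_insert_min hI
  obtain ⟨j, J', hj, hj', rfl⟩ := exists_insert_min hJ
  rw [card_insert_of_notMem hi'] at hN
  rw [rowMinor_insert _ hi, rowMinor_insert _ hj, sum_insert hi', sum_insert hj']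
  rw [below_insert_self hj, below_insert_self hi, erase_insert hj', erase_insert hi', ih _ (by omega) I' J' rfl]
  congr 1
  have h1 : ∀ l ∈ J', (-q) ^ below (insert j J') l •
      (x i l * rowMinor q x I' ((insert j J').erase l)) =
      ∑ i' ∈ I', (-q) ^ (below J' l + 1 + below I' i') •
        (x i l * x i' j * rowMinor q x (I'.erase i') (J'.erase l)) := by
    intro l hl
    have hlt := hj l hl
    rw [below_insert_of_lt hj' hlt, erase_insert_of_ne hlt.ne, ih _ (by omega) _ _ rfl,
      rowMinor_insert _ (fun a ha => hj a (mem_of_mem_erase ha)), mul_sum, smul_sum]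
    refine sum_congr rfl fun i' hi'' => ?_
    rw [← ih _ _ (I'.erase i') _ rfl, pow_add _ (_ + 1), mul_smul, mul_smul_comm, mul_assoc]
    have := card_erase_lt_of_mem hi''
    omega
  have h2 : ∀ i' ∈ I', (-q) ^ below (insert i I') i' •
      (x i' j * rowMinor q (fun j i => x i j) J' ((insert i I').erase i')) =
      ∑ l ∈ J', (-q) ^ (below J' l + 1 + below I' i') •
        (x i l * x i' j * rowMinor q x (I'.erase i') (J'.erase l)) := by
    intro i' hi''
    have hlt := hi i' hi''
    rw [below_insert_of_lt hi' hlt, erase_insert_of_ne hlt.ne, ← ih _ _ _ _ rfl,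
      rowMinor_insert _ (fun a ha => hi a (mem_of_mem_erase ha)), mul_sum, smul_sum]
    · refine sum_congr rfl fun l hl => ?_
      rw [h.anti i i' j l hlt (hj l hl), mul_smul_comm, smul_smul, ← pow_add, mul_assoc]
      congr 2
      ring
    · rw [card_insert_of_notMem (fun hh => hi' (mem_of_mem_erase hh)), card_erase_of_mem hi'']
      have := card_pos.2 ⟨_, hi''⟩
      omega
  rw [sum_congr rfl h1, sum_congr rfl h2, sum_comm]

end Minor

/-! ### The quantum exchange relation -/

section Exchange

variable {k : Type*} [Field k] {ι κ A : Type*} [LinearOrder ι] [LinearOrder κ] [Fintype ι]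
  [Ring A] [Algebra k A] {q : k}

/-- The maximal minor of `x` on a sequence of columns, expanded along columns. -/
def colDet (q : k) (x : ι → κ → A) (l : List κ) : A :=
  wedgeList q (l.map fun j i => x i j) (vac ι A) univ

theorem IsQMat.colDet_append_sort {x : ι → κ → A} (h : IsQMat q x) (l : List κ)
    (P : Finset κ) :
    colDet q x (l ++ P.sort (· ≤ ·)) = ∑ S : Finset ι, (-q) ^ crossings S (univ \ S) •
      (wedgeList q (l.map fun j i => x i j) (vac ι A) S * rowMinor q x (univ \ S) P) := by
  rw [colDet, List.map_append, wedgeList_append, wedgeList_eq_sum, powerset_univ]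
  refine sum_congr rfl fun S _ => ?_
  rw [h.rowMinor_transpose]
  rfl

theorem IsQMat.colDet_sort_append {x : ι → κ → A} (h : IsQMat q x) (l : List κ)
    (P : Finset κ) :
    colDet q x (P.sort (· ≤ ·) ++ l) = ∑ S : Finset ι, (-q) ^ crossings S (univ \ S) •
      (rowMinor q x S P *
        wedgeList q (l.map fun j i => x i j) (vac ι A) (univ \ S)) := by
  rw [colDet, List.map_append, wedgeList_append, wedgeList_eq_sum, powerset_univ]
  refine sum_congr rfl fun S _ => ?_
  rw [h.rowMinor_transpose]
  rfl

/-- The sum is the coordinate at `K` of the wedge of the rows in `S` followed by those in `S'`.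
Either a row repeats and the wedge is zero, or there are fewer than `#K` rows and the degree is
wrong. -/
theorem IsQMat.sum_rowMinor_mul_rowMinor (hq : q ≠ 0) {x : ι → κ → A} (h : IsQMat q x)
    {K : Finset κ} (hK : Fintype.card ι < #K) (S S' : Finset ι) :
    ∑ P ∈ K.powerset, (-q) ^ crossings P (K \ P) •
      (rowMinor q x S P * rowMinor q x S' (K \ P)) = 0 := by
  simp only [rowMinor]
  rw [← wedgeList_eq_sum, ← wedgeList_append, ← List.map_append]
  by_cases hn : (S.sort (· ≤ ·) ++ S'.sort (· ≤ ·)).Nodup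
  · refine wedgeList_vac_of_card_ne _ ?_
    have := hn.length_le_card
    rw [List.length_map]
    omega
  · rw [h.wedgeList_of_not_nodup hq hn, Pi.zero_apply]

/-- The quantum exchange relation. -/
theorem IsQMat.exchange (hq : q ≠ 0) {x : ι → κ → A} (h : IsQMat q x)
    {K : Finset κ} (hK : Fintype.card ι < #K) (l l' : List κ) :
    ∑ P ∈ K.powerset, (-q) ^ crossings P (K \ P) •
      (colDet q x (l ++ P.sort (· ≤ ·)) * colDet q x ((K \ P).sort (· ≤ ·) ++ l')) = 0 := by
  -- Splitting `l` off the first determinant and `l'` off the second leaves outer factors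
  -- independent of `P`, so the sum over `P` acts only on the middle product.
  have h1 : ∀ P ∈ K.powerset, (-q) ^ crossings P (K \ P) •
      (colDet q x (l ++ P.sort (· ≤ ·)) * colDet q x ((K \ P).sort (· ≤ ·) ++ l')) =
      ∑ S : Finset ι, ∑ S' : Finset ι,
        ((-q) ^ crossings S (univ \ S) * (-q) ^ crossings S' (univ \ S')) •
        (wedgeList q (l.map fun j i => x i j) (vac ι A) S *
          ((-q) ^ crossings P (K \ P) •
            (rowMinor q x (univ \ S) P * rowMinor q x S' (K \ P))) *
          wedgeList q (l'.map fun j i => x i j) (vac ι A) (univ \ S')) := by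
    intro P _
    rw [h.colDet_append_sort, h.colDet_sort_append, sum_mul_sum, smul_sum]
    refine sum_congr rfl fun S _ => ?_
    rw [smul_sum]
    refine sum_congr rfl fun S' _ => ?_
    simp only [smul_mul_assoc, mul_smul_comm, smul_smul, mul_assoc]
    congr 1
    ring
  rw [sum_congr rfl h1, sum_comm]
  refine sum_eq_zero fun S _ => ?_
  rw [sum_comm]
  refine sum_eq_zero fun S' _ => ?_
  rw [← smul_sum, ← sum_mul, ← mul_sum, h.sum_rowMinor_mul_rowMinor hq hK]
  simp

end Exchange

/-! ### Inversions under removal of the first value of a permutation -/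

section Perm

/-- The permutation of `Fin (s + 1)` with `0 ↦ p` that acts as `τ` on the remaining points. -/
noncomputable def consPerm {s : ℕ} (p : Fin (s + 1)) (τ : Equiv.Perm (Fin s)) :
    Equiv.Perm (Fin (s + 1)) :=
  Equiv.ofBijective (Fin.cons p fun a => p.succAbove (τ a)) <| by
    rw [← Finite.injective_iff_bijective, Fin.cons_injective_iff]
    refine ⟨?_, p.succAbove_right_injective.comp τ.injective⟩
    rintro ⟨a, ha⟩
    exact Fin.succAbove_ne _ _ ha

@[simp] theorem consPerm_zero {s : ℕ} (p : Fin (s + 1)) (τ : Equiv.Perm (Fin s)) :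
    consPerm p τ 0 = p := rfl

@[simp] theorem consPerm_succ {s : ℕ} (p : Fin (s + 1)) (τ : Equiv.Perm (Fin s)) (a : Fin s) :
    consPerm p τ a.succ = p.succAbove (τ a) := rfl

theorem consPerm_bijective (s : ℕ) :
    Function.Bijective fun a : Fin (s + 1) × Equiv.Perm (Fin s) => consPerm a.1 a.2 := by
  rw [Fintype.bijective_iff_injective_and_card]
  constructor
  · rintro ⟨p, τ⟩ ⟨p', τ'⟩ h
    have h0 : p = p' := by simpa using DFunLike.congr_fun h 0
    subst h0
    refine Prod.ext rfl (Equiv.ext fun a => ?_)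
    simpa using DFunLike.congr_fun h a.succ
  · simp [Fintype.card_perm, Nat.factorial_succ]

theorem card_castSucc_lt {s : ℕ} (p : Fin (s + 1)) :
    #{c : Fin s | c.castSucc < p} = p := by
  have h : ({c : Fin s | c.castSucc < p} : Finset (Fin s)).map Fin.castSuccEmb = Iio p := by
    ext a
    simp only [mem_map, mem_filter, mem_univ, true_and, mem_Iio]
    constructor
    · rintro ⟨c, hc, rfl⟩; exact hc
    · intro ha
      exact ⟨a.castPred (ne_of_lt (lt_of_lt_of_le ha (Fin.le_last p))), by simpa, by simp⟩
  rw [← card_map, h, Fin.card_Iio]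

/-- The first position is inverted with exactly the `p` smaller values, and `succAbove` preserves
order among the others. -/
theorem invCount_consPerm {s : ℕ} (p : Fin (s + 1)) (τ : Equiv.Perm (Fin s)) :
    invCount (consPerm p τ) = p + invCount τ := by
  unfold invCount
  simp only [card_filter, Fintype.sum_prod_type, Fin.sum_univ_succ, consPerm_zero, consPerm_succ,
    Fin.succ_pos, Fin.not_lt_zero, Fin.succ_lt_succ_iff, false_and, true_and, if_false,
    zero_add, Fin.succAbove_lt_succAbove_iff, Fin.succAbove_lt_iff_castSucc_lt]
  congr 1
  rw [Equiv.sum_comp τ (fun c => if c.castSucc < p then 1 else 0), ← card_filter,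
    card_castSucc_lt]

end Perm

/-! ### Maximal minors and straightening of a product of two -/

section MaxMinor

variable {k : Type*} [Field k] {q : k}

theorem below_map {κ : Type*} [LinearOrder κ] {s : ℕ} (J : Fin s ↪o κ) (p : Fin s) :
    below (univ.map J.toEmbedding) (J p) = p := by
  unfold below
  rw [filter_map, card_map]
  have : (univ.filter ((fun t => t < J p) ∘ J.toEmbedding)) = Iio p := by
    ext a; simp
  rw [this, Fin.card_Iio]

theorem wedgeList_ofFn {ι κ A : Type*} [LinearOrder κ] [Ring A] [Algebra k A]
    (x : ι → κ → A) {s : ℕ} (I : Fin s → ι) (J : Fin s ↪o κ) :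
    wedgeList q (List.ofFn fun a => x (I a)) (vac κ A) (univ.map J.toEmbedding) =
      ∑ σ : Equiv.Perm (Fin s),
        (-q) ^ invCount σ • (List.ofFn fun a : Fin s => x (I a) (J (σ a))).prod := by
  induction s with
  | zero => simp [vac, invCount]
  | succ s ih =>
    rw [List.ofFn_succ, wedgeList_cons, wedge_apply, sum_map,
      ← (consPerm_bijective s).sum_comp, Fintype.sum_prod_type]
    refine sum_congr rfl fun p _ => ?_
    have he : (univ.map J.toEmbedding).erase (J.toEmbedding p) =
        univ.map ((Fin.succAboveOrderEmb p).trans J).toEmbedding := by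
      ext t
      simp only [mem_erase, mem_map, mem_univ, true_and]
      constructor
      · rintro ⟨h1, a, rfl⟩
        have : a ≠ p := by rintro rfl; exact h1 rfl
        obtain ⟨b, rfl⟩ := Fin.exists_succAbove_eq this
        exact ⟨b, rfl⟩
      · rintro ⟨b, rfl⟩
        exact ⟨fun h => Fin.succAbove_ne p b (J.injective h), _, rfl⟩
    rw [he, ih (fun a => I a.succ), mul_sum, smul_sum]
    refine sum_congr rfl fun τ _ => ?_
    rw [invCount_consPerm, List.ofFn_succ, List.prod_cons, mul_smul_comm, smul_smul, ← pow_add]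
    congr 2
    exact congrArg (· + _) (below_map J p)

theorem sort_map_univ {κ : Type*} [LinearOrder κ] {s : ℕ} (J : Fin s ↪o κ) :
    (univ.map J.toEmbedding).sort (· ≤ ·) = List.ofFn J := by
  rw [List.ofFn_eq_map, ← Fin.sort_univ]
  exact (J.strictMono.strictMonoOn _).map_finsetSort.symm

variable {m n : ℕ}

theorem colDet_ofFn (J : Fin m ↪o Fin n) :
    colDet q (fun (i : Fin m) (j : Fin n) => X q i j) (List.ofFn J) = maxMinor q J := by
  rw [colDet, ← sort_map_univ]
  change rowMinor q _ _ _ = _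
  rw [← (isQMat_X q m n).rowMinor_transpose, rowMinor, Fin.sort_univ, ← List.ofFn_eq_map]
  exact wedgeList_ofFn (fun (i : Fin m) (j : Fin n) => X q i j) id J

theorem exists_colDet_eq_of_perm (hq : q ≠ 0) (J : Fin m ↪o Fin n) {l : List (Fin n)}
    (hl : l.Perm (List.ofFn J)) :
    ∃ s : k, s ≠ 0 ∧
      colDet q (fun (i : Fin m) (j : Fin n) => X q i j) l = s • maxMinor q J := by
  obtain ⟨s, hs, h⟩ := (isQMat_X q m n).transpose.exists_wedgeList_perm hq hl
  refine ⟨s, hs, ?_⟩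
  rw [← colDet_ofFn, colDet, h]
  rfl

theorem colDet_eq_zero_or (hq : q ≠ 0) (l : List (Fin n)) :
    colDet q (fun (i : Fin m) (j : Fin n) => X q i j) l = 0 ∨
      ∃ (J : Fin m ↪o Fin n) (s : k), l.Perm (List.ofFn J) ∧
        colDet q (fun (i : Fin m) (j : Fin n) => X q i j) l = s • maxMinor q J := by
  by_cases hn : l.Nodup
  · by_cases hm : l.length = m
    · right
      have hc : #l.toFinset = m := by rw [List.toFinset_card_of_nodup hn, hm]
      have hl : l.Perm (List.ofFn (l.toFinset.orderEmbOfFin hc)) := by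
        rw [← sort_map_univ, map_orderEmbOfFin_univ]
        exact ((sort_perm_toList _ _).trans (List.toFinset_toList hn)).symm
      obtain ⟨s, _, hs⟩ := exists_colDet_eq_of_perm hq _ hl
      exact ⟨_, s, hl, hs⟩
    · left
      refine wedgeList_vac_of_card_ne _ ?_
      simpa [eq_comm] using hm
  · left
    rw [colDet, (isQMat_X q m n).transpose.wedgeList_of_not_nodup hq hn, Pi.zero_apply]

/-- The sum of the entries of a row. -/
def rowSum (J : Fin m ↪o Fin n) : ℕ := ∑ a, (J a : ℕ)

theorem rowSum_eq_of_perm {J : Fin m ↪o Fin n} {l : List (Fin n)} (h : l.Perm (List.ofFn J)) :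
    rowSum J = (l.map Fin.val).sum := by
  rw [(h.map Fin.val).sum_eq, List.map_ofFn, List.sum_ofFn]
  rfl

theorem sum_map_sort (P : Finset (Fin n)) :
    ((P.sort (· ≤ ·)).map Fin.val).sum = ∑ a ∈ P, (a : ℕ) := by
  rw [((sort_perm_toList P (· ≤ ·)).map Fin.val).sum_eq, sum_map_toList]

/-- Equally many elements enter and leave; those entering are at most `b`, those leaving at least
`a`. -/
theorem sum_lt_sum_of_card_eq {P P₀ : Finset (Fin n)} {b a : Fin n} (hba : b < a)
    (hcard : #P = #P₀) (hne : P ≠ P₀) (hP : ∀ t ∈ P \ P₀, t ≤ b) (hP₀ : ∀ t ∈ P₀, a ≤ t) :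
    ∑ t ∈ P, (t : ℕ) < ∑ t ∈ P₀, (t : ℕ) := by
  rw [← sum_sdiff_lt_sum_sdiff]
  have hc : #(P \ P₀) = #(P₀ \ P) := card_sdiff_comm hcard
  have hpos : 0 < #(P₀ \ P) := by
    rw [← hc, card_pos, sdiff_nonempty]
    exact fun hs => hne (eq_of_subset_of_card_le hs hcard.ge)
  calc ∑ t ∈ P \ P₀, (t : ℕ) ≤ #(P \ P₀) • (b : ℕ) :=
        sum_le_card_nsmul _ _ _ fun t ht => hP t ht
    _ < #(P₀ \ P) • (a : ℕ) := by
        rw [hc, smul_eq_mul, smul_eq_mul]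
        exact Nat.mul_lt_mul_of_pos_left hba hpos
    _ ≤ ∑ t ∈ P₀ \ P, (t : ℕ) :=
        card_nsmul_le_sum _ _ _ fun t ht => hP₀ t (mem_sdiff.1 ht).1

theorem perm_ofFn_of_partition (J : Fin m ↪o Fin n) {S S' : Finset (Fin m)}
    (hd : Disjoint S S') (hu : S ∪ S' = univ) :
    ((S.map J.toEmbedding).sort (· ≤ ·) ++ (S'.map J.toEmbedding).sort (· ≤ ·)).Perm
      (List.ofFn J) := by
  rw [← sort_map_univ, ← hu, map_union]
  rw [← Multiset.coe_eq_coe, ← Multiset.coe_add, sort_eq, sort_eq, sort_eq,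
    ← disjUnion_eq_union _ _ ((disjoint_map _).2 hd)]
  rfl

/-- Straightening of a product of two maximal minors. -/
theorem maxMinor_mul_mem_span (hq : q ≠ 0) {A B : Fin m ↪o Fin n} {i : Fin m}
    (hi : B i < A i) :
    maxMinor q A * maxMinor q B ∈ Submodule.span k
      {y | ∃ A' B' : Fin m ↪o Fin n, rowSum A' < rowSum A ∧
        rowSum A' + rowSum B' = rowSum A + rowSum B ∧ y = maxMinor q A' * maxMinor q B'} := by
  set x : Fin m → Fin n → QMatrix q m n := fun i j => X q i j with hx
  -- The columns exchanged are the entries of `A` from position `i` on and those of `B` up to `i`.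
  -- Since `B i < A i` these sets are disjoint, so together they have `m + 1` elements.
  set P₀ : Finset (Fin n) := (Ici i).map A.toEmbedding with hP₀
  set Q₀ : Finset (Fin n) := (Iic i).map B.toEmbedding with hQ₀
  set l := ((Iio i).map A.toEmbedding).sort (· ≤ ·) with hl
  set l' := ((Ioi i).map B.toEmbedding).sort (· ≤ ·) with hl'
  have hPmem : ∀ t ∈ P₀, A i ≤ t := by
    intro t ht
    obtain ⟨a, ha, rfl⟩ := mem_map.1 ht
    exact A.monotone (mem_Ici.1 ha)
  have hQmem : ∀ t ∈ Q₀, t ≤ B i := by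
    intro t ht
    obtain ⟨a, ha, rfl⟩ := mem_map.1 ht
    exact B.monotone (mem_Iic.1 ha)
  have hdisj : Disjoint P₀ Q₀ := disjoint_left.2 fun t h1 h2 =>
    absurd ((hPmem t h1).trans (hQmem t h2)) hi.not_ge
  set K := P₀ ∪ Q₀ with hK
  have hKcard : Fintype.card (Fin m) < #K := by
    rw [hK, card_union_of_disjoint hdisj, hP₀, hQ₀, card_map, card_map, Fin.card_Ici,
      Fin.card_Iic, Fintype.card_fin]
    omega
  have hKP : K \ P₀ = Q₀ := by rw [hK, union_sdiff_cancel_left hdisj]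
  have permA : (l ++ P₀.sort (· ≤ ·)).Perm (List.ofFn A) := by
    refine perm_ofFn_of_partition A (disjoint_left.2 fun t h1 h2 => ?_) ?_
    · exact absurd (mem_Iio.1 h1) (mem_Ici.1 h2).not_gt
    · ext t; simp [lt_or_ge]
  have permB : (Q₀.sort (· ≤ ·) ++ l').Perm (List.ofFn B) := by
    refine perm_ofFn_of_partition B (disjoint_left.2 fun t h1 h2 => ?_) ?_
    · exact absurd (mem_Iic.1 h1) (mem_Ioi.1 h2).not_ge
    · ext t; simp [le_or_gt]
  obtain ⟨s, hs, hA⟩ := exists_colDet_eq_of_perm hq A permA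
  obtain ⟨s', hs', hB⟩ := exists_colDet_eq_of_perm hq B permB
  have hmem : P₀ ∈ K.powerset := mem_powerset.2 subset_union_left
  have hex := (isQMat_X q m n).exchange hq hKcard l l'
  rw [← add_sum_erase _ _ hmem, hKP, hA, hB, smul_mul_smul_comm, smul_smul] at hex
  have hne : (-q) ^ crossings P₀ Q₀ * (s * s') ≠ 0 :=
    mul_ne_zero (pow_ne_zero _ (neg_ne_zero.2 hq)) (mul_ne_zero hs hs')
  -- The term `P = P₀` is a nonzero multiple of `[A][B]`, so the exchange relation solves for it.
  rw [← Submodule.smul_mem_iff _ hne, eq_neg_of_add_eq_zero_left hex]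
  refine Submodule.neg_mem _ (Submodule.sum_mem _ fun P hP => Submodule.smul_mem _ _ ?_)
  rw [mem_erase, mem_powerset] at hP
  rcases colDet_eq_zero_or (m := m) hq (l ++ P.sort (· ≤ ·)) with h0 | ⟨A', t, hA', h1⟩
  · rw [h0, zero_mul]; exact Submodule.zero_mem _
  rcases colDet_eq_zero_or (m := m) hq ((K \ P).sort (· ≤ ·) ++ l') with h0 | ⟨B', t', hB', h2⟩
  · rw [h0, mul_zero]; exact Submodule.zero_mem _
  rw [h1, h2, smul_mul_smul_comm]
  refine Submodule.smul_mem _ _ (Submodule.subset_span ⟨A', B', ?_, ?_, rfl⟩)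
  · rw [rowSum_eq_of_perm hA', rowSum_eq_of_perm permA, List.map_append, List.map_append,
      List.sum_append, List.sum_append, sum_map_sort P, sum_map_sort P₀]
    -- A surviving `P` has the size of `P₀`, and whatever it contains outside `P₀` lies in `Q₀`,
    -- hence is at most `B i`.
    refine Nat.add_lt_add_left (sum_lt_sum_of_card_eq hi ?_ hP.1 ?_ hPmem) _
    · have e1 := hA'.length_eq
      have e2 := permA.length_eq
      simp only [List.length_append, length_sort, List.length_ofFn] at e1 e2
      omega
    · intro t ht
      rw [mem_sdiff] at ht
      rcases mem_union.1 (hP.2 ht.1) with h | h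
      · exact absurd h ht.2
      · exact hQmem t h
  · rw [rowSum_eq_of_perm hA', rowSum_eq_of_perm permA, rowSum_eq_of_perm hB',
      rowSum_eq_of_perm permB]
    simp only [List.map_append, List.sum_append, sum_map_sort]
    have e1 := sum_sdiff (f := fun t : Fin n => (t : ℕ)) hP.2
    have e2 := sum_sdiff (f := fun t : Fin n => (t : ℕ)) (mem_powerset.1 hmem)
    rw [hKP] at e2
    omega

end MaxMinor

/-! ### Preferred products span -/

section Straightening

variable {k : Type*} [Field k] {q : k} {m n : ℕ}

/-- The sum of the entries of a tableau, each counted with the number of rows from its own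
row downwards. -/
def Tableau.height : Tableau m n → ℕ
  | [] => 0
  | J :: T => (T.length + 1) * rowSum J + Tableau.height T

/-- The upper of two adjacent rows counts once more than the lower, so moving entry sum downwards
lowers the height, whatever the neighbouring rows. -/
theorem Tableau.height_lt {A B A' B' : Fin m ↪o Fin n} (h : rowSum A' < rowSum A)
    (h' : rowSum A' + rowSum B' = rowSum A + rowSum B) (U V : Tableau m n) :
    Tableau.height (U ++ A' :: B' :: V) < Tableau.height (U ++ A :: B :: V) := by
  induction U with
  | nil =>
    simp only [List.nil_append, Tableau.height, List.length_cons]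
    have e : (V.length + 1) * rowSum A' + (V.length + 1) * rowSum B' =
      (V.length + 1) * rowSum A + (V.length + 1) * rowSum B := by
      rw [← mul_add, ← mul_add, h']
    rw [add_mul (V.length + 1) 1, add_mul (V.length + 1) 1]
    omega
  | cons J U ih =>
    simp only [List.cons_append, Tableau.height, List.length_append, List.length_cons]
    omega

theorem coe_tableauProduct (T : Tableau m n) :
    (tableauProduct q T : QMatrix q m n) = (T.map fun J => maxMinor q J).prod := by
  rw [tableauProduct, ← Subalgebra.coe_val, map_list_prod, List.map_map]
  rfl

theorem prod_maxMinor_mem_span (hq : q ≠ 0) (T : Tableau m n) :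
    (T.map fun J => maxMinor q J).prod ∈ Submodule.span k
      (Set.range fun T : {T : Tableau m n // T.Preferred} =>
        (T.1.map fun J => maxMinor q J).prod) := by
  induction hN : T.height using Nat.strong_induction_on generalizing T with
  | _ N ih =>
  by_cases hT : T.Preferred
  · exact Submodule.subset_span ⟨⟨T, hT⟩, rfl⟩
  · rw [Tableau.Preferred, List.isChain_iff_forall_rel_of_append_cons_cons] at hT
    push Not at hT
    obtain ⟨A, B, U, V, rfl, hAB⟩ := hT
    simp only [StarLE, not_forall, not_le] at hAB
    obtain ⟨i, hi⟩ := hAB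
    have hmem := maxMinor_mul_mem_span hq hi
    simp only [List.map_append, List.map_cons, List.prod_append, List.prod_cons]
    rw [← mul_assoc (maxMinor q A)]
    generalize maxMinor q A * maxMinor q B = y at hmem
    induction hmem using Submodule.span_induction with
    | mem y hy =>
      obtain ⟨A', B', h1, h2, rfl⟩ := hy
      have := ih _ (hN ▸ Tableau.height_lt h1 h2 U V) (U ++ A' :: B' :: V) rfl
      simpa only [List.map_append, List.map_cons, List.prod_append, List.prod_cons,
        mul_assoc] using this
    | zero => simp
    | add y z _ _ hy hz =>
      rw [add_mul, mul_add]
      exact Submodule.add_mem _ hy hz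
    | smul c y _ hy =>
      rw [smul_mul_assoc, mul_smul_comm]
      exact Submodule.smul_mem _ _ hy

theorem grassmannian_toSubmodule_le (hq : q ≠ 0) :
    Subalgebra.toSubmodule (grassmannian q m n) ≤ Submodule.span k
      (Set.range fun T : {T : Tableau m n // T.Preferred} =>
        (T.1.map fun J => maxMinor q J).prod) := by
  rw [grassmannian, Algebra.adjoin_eq_span, Submodule.span_le]
  intro y hy
  obtain ⟨l, hl, rfl⟩ := Submonoid.exists_list_of_mem_closure hy
  obtain ⟨T, rfl⟩ : ∃ T : Tableau m n, T.map (fun J => maxMinor q J) = l := by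
    rw [← Set.mem_range, Set.range_list_map]
    exact hl
  exact prod_maxMinor_mem_span hq T

theorem span_tableauProduct (hq : q ≠ 0) :
    Submodule.span k (Set.range fun T : {T : Tableau m n // T.Preferred} =>
      tableauProduct q T.1) = ⊤ := by
  rw [eq_top_iff]
  rintro ⟨y, hy⟩ -
  have h := grassmannian_toSubmodule_le hq hy
  have himg : (Set.range fun T : {T : Tableau m n // T.Preferred} =>
      (T.1.map fun J => maxMinor q J).prod) =
      (Subalgebra.toSubmodule (grassmannian q m n)).subtype ''
        Set.range fun T : {T : Tableau m n // T.Preferred} => tableauProduct q T.1 := by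
    rw [← Set.range_comp]
    congr 1
    ext T
    exact (coe_tableauProduct T.1).symm
  rw [himg, Submodule.span_image] at h
  obtain ⟨z, hz, hzy⟩ := h
  have : z = ⟨y, hy⟩ := Subtype.ext hzy
  exact this ▸ hz

end Straightening

/-! ### Products of quantum matrices -/

section RTT

variable {k : Type*} [Field k] {ι κ μ A : Type*} [LinearOrder ι] [LinearOrder κ] [LinearOrder μ]
  [Ring A] [Algebra k A] {q : k}

/-- The diagonal coefficients of the braiding. -/
def braidF (q : k) (a b : ι) : k := if a = b then q else 1

/-- The off-diagonal coefficients of the braiding. -/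
def braidG (q : k) (a b : ι) : k := if a < b then q - q⁻¹ else 0

theorem braidF_comm (q : k) (a b : ι) : braidF q a b = braidF q b a := by
  simp [braidF, eq_comm]

/-- The relations of quantum matrices, in the uniform shape of a braid commutation relation. -/
def IsRTT (q : k) (x : ι → κ → A) : Prop := ∀ i i' j l,
  braidF q i i' • (x i' j * x i l) + braidG q i i' • (x i j * x i' l) =
    braidF q j l • (x i l * x i' j) + braidG q j l • (x i j * x i' l)

theorem IsRTT.isQMat {x : ι → κ → A} (h : IsRTT q x) : IsQMat q x := by
  have anti : ∀ i i' j l, i < i' → j < l → x i l * x i' j = x i' j * x i l := by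
    intro i i' j l hi hj
    simpa [braidF, braidG, hi.ne', hj.ne', hi.not_gt, hj.not_gt] using h i' i l j
  refine ⟨fun i j l hj => ?_, fun i i' j hi => ?_, anti, fun i i' j l hi hj => ?_⟩
  · simpa [braidF, braidG, hj.ne', hj.not_gt] using (h i i l j).symm
  · simpa [braidF, braidG, hi.ne', hi.not_gt] using h i' i j j
  · rw [anti i i' j l hi hj, sub_eq_iff_eq_add, add_comm]
    simpa [braidF, braidG, hi.ne', hj.ne, hi.not_gt, hj] using h i' i j l

theorem IsQMat.isRTT (hq : q ≠ 0) {x : ι → κ → A} (h : IsQMat q x) : IsRTT q x := by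
  have inv : ∀ {y z : A}, y = q • z → z + (q - q⁻¹) • y = q • y := by
    rintro y z rfl
    rw [sub_smul, smul_smul q⁻¹, inv_mul_cancel₀ hq, one_smul]
    abel
  intro i i' j l
  rcases lt_trichotomy i i' with hi | rfl | hi <;> rcases lt_trichotomy j l with hj | rfl | hj
  · simp [braidF, braidG, hi.ne, hj.ne, hi, hj, h.anti i i' j l hi hj]
  · simp [braidF, braidG, hi.ne, hi, inv (h.col i i' j hi)]
  · have := h.diag i i' l j hi hj
    rw [sub_eq_iff_eq_add] at this
    simp [braidF, braidG, hi.ne, hj.ne', hi, hj.not_gt, this, add_comm]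
  · simp [braidF, braidG, hj.ne, hj, inv (h.row i j l hj)]
  · simp [braidF, braidG]
  · simp [braidF, braidG, hj.ne', hj.not_gt, (h.row i l j hj).symm]
  · have := h.diag i' i j l hi hj
    rw [sub_eq_iff_eq_add] at this
    simp [braidF, braidG, hi.ne', hj.ne, hi.not_gt, hj, this, h.anti i' i j l hi hj, add_comm]
  · simp [braidF, braidG, hi.ne', hi.not_gt, h.col i' i j hi]
  · simp [braidF, braidG, hi.ne', hj.ne', hi.not_gt, hj.not_gt, h.anti i' i l j hi hj]

/-- The product of two quantum matrices with mutually commuting entries satisfies the braid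
commutation relation. -/
theorem IsRTT.mul [Fintype κ] {x : ι → κ → A} {y : κ → μ → A} (hx : IsRTT q x) (hy : IsRTT q y)
    (hc : ∀ i j j' l, Commute (x i j) (y j' l)) :
    IsRTT q (fun i l => ∑ j, x i j * y j l) := by
  intro i i' j l
  have e : ∀ i i' j l, (∑ a, x i a * y a j) * ∑ b, x i' b * y b l =
      ∑ a, ∑ b, (x i a * x i' b) * (y a j * y b l) := by
    intro i i' j l
    rw [sum_mul_sum]
    refine sum_congr rfl fun a _ => sum_congr rfl fun b _ => ?_
    rw [mul_assoc, ← mul_assoc (y a j), ← (hc i' b a j).eq]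
    simp only [mul_assoc]
  simp only [e, smul_sum, ← sum_add_distrib]
  -- The relation for `x` transfers the coefficients from the outer rows to the summation indices,
  -- and the relation for `y` (in `h2`) transfers them to the outer columns.
  have h1 : ∀ a b, braidF q i i' • ((x i' a * x i b) * (y a j * y b l)) +
      braidG q i i' • ((x i a * x i' b) * (y a j * y b l)) =
      braidF q a b • ((x i b * x i' a) * (y a j * y b l)) +
      braidG q a b • ((x i a * x i' b) * (y a j * y b l)) := by
    intro a b
    simpa only [add_mul, smul_mul_assoc] using
      congrArg (· * (y a j * y b l)) (hx i i' a b)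
  have h2 : ∀ a b, braidF q a b • ((x i a * x i' b) * (y b j * y a l)) +
      braidG q a b • ((x i a * x i' b) * (y a j * y b l)) =
      braidF q j l • ((x i a * x i' b) * (y a l * y b j)) +
      braidG q j l • ((x i a * x i' b) * (y a j * y b l)) := by
    intro a b
    simpa only [mul_add, mul_smul_comm] using
      congrArg ((x i a * x i' b) * ·) (hy a b j l)
  calc _ = ∑ a, ∑ b, (braidF q a b • ((x i b * x i' a) * (y a j * y b l)) +
      braidG q a b • ((x i a * x i' b) * (y a j * y b l))) :=
        sum_congr rfl fun a _ => sum_congr rfl fun b _ => h1 a b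
    _ = ∑ a, ∑ b, (braidF q a b • ((x i a * x i' b) * (y b j * y a l)) +
      braidG q a b • ((x i a * x i' b) * (y a j * y b l))) := by
        simp only [sum_add_distrib]
        congr 1
        rw [sum_comm]
        exact sum_congr rfl fun a _ => sum_congr rfl fun b _ => by rw [braidF_comm]
    _ = _ := sum_congr rfl fun a _ => sum_congr rfl fun b _ => h2 a b

end RTT

/-! ### Weighted shifts and leading terms -/

section Shift

variable {k : Type*} [Field k] {E M : Type*} [AddCommMonoid E] [AddCommGroup M] [Module k M]
  (β : Module.Basis E k M)

/-- The weighted shift by `e` on a vector space with basis indexed by `E`. -/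
noncomputable def shiftOp (c : E → k) (e : E) : Module.End k M :=
  β.constr k fun v => c v • β (v + e)

theorem shiftOp_basis (c : E → k) (e v : E) : shiftOp β c e (β v) = c v • β (v + e) :=
  β.constr_basis k _ v

theorem shiftOp_mul (c c' : E → k) (e e' : E) :
    shiftOp β c e * shiftOp β c' e' = shiftOp β (fun v => c' v * c (v + e')) (e' + e) := by
  refine β.ext fun v => ?_
  rw [Module.End.mul_apply, shiftOp_basis, map_smul, shiftOp_basis, shiftOp_basis, smul_smul,
    add_assoc]

theorem smul_shiftOp (r : k) (c : E → k) (e : E) :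
    r • shiftOp β c e = shiftOp β (fun v => r * c v) e := by
  refine β.ext fun v => ?_
  rw [LinearMap.smul_apply, shiftOp_basis, shiftOp_basis, smul_smul]

theorem shiftOp_one : shiftOp β (fun _ : E => (1 : k)) 0 = 1 := by
  refine β.ext fun v => ?_
  rw [shiftOp_basis]
  simp

variable (w : E →+ ℤ)

/-- The span of the basis vectors of weight at most `t`. -/
def weightLE (t : ℤ) : Submodule k M := Submodule.span k (β '' {v | w v ≤ t})

/-- The operator `x` raises weights by at most `h`. -/
def RaisesLE (h : ℤ) (x : Module.End k M) : Prop :=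
  ∀ t, ∀ f ∈ weightLE β w t, x f ∈ weightLE β w (t + h)

/-- Up to terms of smaller weight, the operator `x` is a weighted shift by `e` with nonzero
coefficients. -/
def IsLead (e : E) (x : Module.End k M) : Prop :=
  ∃ c : E → k, (∀ v, c v ≠ 0) ∧ RaisesLE β w (w e - 1) (x - shiftOp β c e)

variable {β w}

theorem weightLE_mono {t t' : ℤ} (h : t ≤ t') : weightLE β w t ≤ weightLE β w t' :=
  Submodule.span_mono (Set.image_mono fun _ hv => le_trans hv h)

theorem RaisesLE.mono {h h' : ℤ} {x : Module.End k M} (hx : RaisesLE β w h x)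
    (hh : h ≤ h') : RaisesLE β w h' x :=
  fun t f hf => weightLE_mono (by omega) (hx t f hf)

theorem RaisesLE.zero (h : ℤ) : RaisesLE β w h (0 : Module.End k M) :=
  fun _ _ _ => Submodule.zero_mem _

theorem RaisesLE.mul {h h' : ℤ} {x y : Module.End k M} (hx : RaisesLE β w h x)
    (hy : RaisesLE β w h' y) : RaisesLE β w (h + h') (x * y) := by
  intro t f hf
  have := hx _ _ (hy t f hf)
  rwa [add_assoc, add_comm h'] at this

theorem RaisesLE.add {h : ℤ} {x y : Module.End k M} (hx : RaisesLE β w h x)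
    (hy : RaisesLE β w h y) : RaisesLE β w h (x + y) :=
  fun t f hf => Submodule.add_mem _ (hx t f hf) (hy t f hf)

theorem RaisesLE.smul {h : ℤ} {x : Module.End k M} (hx : RaisesLE β w h x) (c : k) :
    RaisesLE β w h (c • x) :=
  fun t f hf => Submodule.smul_mem _ _ (hx t f hf)

theorem RaisesLE.sum {ι : Type*} {s : Finset ι} {h : ℤ} {x : ι → Module.End k M}
    (hx : ∀ i ∈ s, RaisesLE β w h (x i)) : RaisesLE β w h (∑ i ∈ s, x i) := by
  intro t f hf
  rw [LinearMap.sum_apply]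
  exact Submodule.sum_mem _ fun i hi => hx i hi t f hf

theorem raisesLE_shiftOp (c : E → k) (e : E) : RaisesLE β w (w e) (shiftOp β c e) := by
  intro t
  change weightLE β w t ≤ (weightLE β w (t + w e)).comap (shiftOp β c e)
  refine Submodule.span_le.2 ?_
  rintro _ ⟨v, hv, rfl⟩
  rw [SetLike.mem_coe, Submodule.mem_comap, shiftOp_basis]
  refine Submodule.smul_mem _ _ (Submodule.subset_span ⟨v + e, ?_, rfl⟩)
  have : w v ≤ t := hv
  change w (v + e) ≤ t + w e
  rw [map_add]
  omega

theorem IsLead.raisesLE {e : E} {x : Module.End k M} (hx : IsLead β w e x) :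
    RaisesLE β w (w e) x := by
  obtain ⟨c, _, h⟩ := hx
  simpa using (h.mono (by omega)).add (raisesLE_shiftOp c e)

theorem isLead_shiftOp {c : E → k} (hc : ∀ v, c v ≠ 0) (e : E) :
    IsLead β w e (shiftOp β c e) :=
  ⟨c, hc, by rw [sub_self]; exact RaisesLE.zero _⟩

theorem isLead_one : IsLead β w 0 (1 : Module.End k M) := by
  rw [← shiftOp_one β]
  exact isLead_shiftOp (fun _ => one_ne_zero) 0

theorem IsLead.add {e : E} {x y : Module.End k M} (hx : IsLead β w e x)
    (hy : RaisesLE β w (w e - 1) y) : IsLead β w e (x + y) := by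
  obtain ⟨c, hc, h⟩ := hx
  refine ⟨c, hc, ?_⟩
  rw [add_sub_right_comm]
  exact h.add hy

theorem IsLead.mul {e e' : E} {x y : Module.End k M} (hx : IsLead β w e x)
    (hy : IsLead β w e' y) : IsLead β w (e + e') (x * y) := by
  have hy' := hy.raisesLE
  obtain ⟨c, hc, h⟩ := hx
  obtain ⟨c', hc', h'⟩ := hy
  refine ⟨_, fun v => mul_ne_zero (hc' v) (hc (v + e')), ?_⟩
  have e1 : x * y - shiftOp β (fun v => c' v * c (v + e')) (e + e') =
      (x - shiftOp β c e) * y + shiftOp β c e * (y - shiftOp β c' e') := by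
    rw [add_comm e, ← shiftOp_mul, sub_mul, mul_sub]
    abel
  rw [e1, map_add]
  exact ((h.mul hy').mono (by omega)).add (((raisesLE_shiftOp c e).mul h').mono (by omega))

theorem IsLead.list_prod {α : Type*} {e : α → E} {x : α → Module.End k M} {l : List α}
    (h : ∀ a ∈ l, IsLead β w (e a) (x a)) : IsLead β w (l.map e).sum (l.map x).prod := by
  induction l with
  | nil => exact isLead_one
  | cons a l ih =>
    simp only [List.map_cons, List.sum_cons, List.prod_cons]
    exact (h a (by simp)).mul (ih fun b hb => h b (by simp [hb]))

theorem RaisesLE.list_prod {α : Type*} {e : α → ℤ} {x : α → Module.End k M} {l : List α}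
    (h : ∀ a ∈ l, RaisesLE β w (e a) (x a)) : RaisesLE β w (l.map e).sum (l.map x).prod := by
  induction l with
  | nil => simpa using (isLead_one (β := β) (w := w)).raisesLE
  | cons a l ih =>
    simp only [List.map_cons, List.sum_cons, List.prod_cons]
    exact (h a (by simp)).mul (ih fun b hb => h b (by simp [hb]))

/-- Operators with distinct leading exponents take linearly independent values on the vacuum. -/
theorem linearIndependent_of_isLead {α : Type*} {e : α → E} (he : Function.Injective e)
    {x : α → Module.End k M} (hx : ∀ a, IsLead β w (e a) (x a)) :
    LinearIndependent k fun a => x a (β 0) := by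
  classical
  have key : ∀ a b, w (e a) ≤ w (e b) →
      (a = b ∧ β.repr (x a (β 0)) (e b) ≠ 0) ∨ (a ≠ b ∧ β.repr (x a (β 0)) (e b) = 0) := by
    intro a b hab
    obtain ⟨c, hc, h⟩ := hx a
    have h0 := h 0 (β 0) (Submodule.subset_span ⟨0, by simp, rfl⟩)
    rw [LinearMap.sub_apply, shiftOp_basis, zero_add, zero_add, weightLE,
      β.mem_span_image] at h0
    have h1 : β.repr (x a (β 0) - c 0 • β (e a)) (e b) = 0 := by
      by_contra hne
      have : w (e b) ≤ w (e a) - 1 := h0 (Finsupp.mem_support_iff.2 hne)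
      omega
    rw [map_sub, Finsupp.sub_apply, sub_eq_zero] at h1
    rw [h1]
    by_cases hab' : a = b
    · subst hab'
      left
      simpa using hc 0
    · right
      refine ⟨hab', ?_⟩
      have : e a ≠ e b := fun h => hab' (he h)
      simp [this]
  rw [linearIndependent_iff']
  intro s g hg
  by_contra! hne
  obtain ⟨a₀, ha₀, hga₀⟩ := hne
  -- At the exponent `e b` of greatest weight no other term contributes: its leading exponent
  -- differs from `e b`, and its remaining part has weight below that of `e b`.
  obtain ⟨b, hb, hmax⟩ := exists_max_image (s.filter fun a => g a ≠ 0) (fun a => w (e a))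
    ⟨a₀, by simp [ha₀, hga₀]⟩
  rw [mem_filter] at hb
  have h1 := congrArg (fun f => β.repr f (e b)) hg
  simp only [map_sum, map_zero, map_smul, Finsupp.finsetSum_apply, Finsupp.smul_apply,
    Finsupp.zero_apply] at h1
  rw [sum_eq_single b] at h1
  · rcases key b b le_rfl with h | h
    · simp [hb.2, h.2] at h1
    · exact h.1 rfl
  · intro a ha hab
    by_cases hga : g a = 0
    · simp [hga]
    · rcases key a b (hmax a (by simp [ha, hga])) with h | h
      · exact absurd h.1 hab
      · simp [h.2]
  · exact fun h => absurd hb.1 h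

end Shift

theorem IsQMat.comp {k : Type*} [Field k] {ι κ ι' κ' A : Type*} [LinearOrder ι] [LinearOrder κ]
    [LinearOrder ι'] [LinearOrder κ'] [Ring A] [Algebra k A] {q : k} {x : ι → κ → A}
    (h : IsQMat q x) {f : ι' → ι} {g : κ' → κ} (hf : StrictMono f) (hg : StrictMono g) :
    IsQMat q (fun i j => x (f i) (g j)) where
  row _ _ _ hj := h.row _ _ _ (hg hj)
  col _ _ _ hi := h.col _ _ _ (hf hi)
  anti _ _ _ _ hi hj := h.anti _ _ _ _ (hf hi) (hg hj)
  diag _ _ _ _ hi hj := h.diag _ _ _ _ (hf hi) (hg hj)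

/-- Exponents of monomials: variables indexed by pairs of naturals, and a multidegree. -/
abbrev Expo (n : ℕ) : Type := (ℕ × ℕ →₀ ℕ) × (Fin n →₀ ℕ)

/-- The product of the variables `(p, b)` with `j < b ≤ l`. -/
noncomputable def seg (p j l : ℕ) : ℕ × ℕ →₀ ℕ := ∑ b ∈ Ioc j l, Finsupp.single (p, b) 1

theorem seg_apply (p j l p' b : ℕ) :
    seg p j l (p', b) = if p = p' ∧ j < b ∧ b ≤ l then 1 else 0 := by
  rw [seg, Finsupp.finsetSum_apply]
  by_cases h : p = p'
  · subst h
    simp [Finsupp.single_apply]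
  · simp [h]

/-! ### The triangular model -/

section Model

variable {k : Type*} [Field k] {n : ℕ} {M : Type*} [AddCommGroup M] [Module k M]
  (β : Module.Basis (Expo n) k M) (q : k)

/-- The shift by `e` weighted with powers of `q`. -/
noncomputable def qShift (a : Expo n → ℤ) (e : Expo n) : Module.End k M :=
  shiftOp β (fun v => q ^ a v) e

variable {q} in
theorem qShift_mul (hq : q ≠ 0) (a a' : Expo n → ℤ) (e e' : Expo n) :
    qShift β q a e * qShift β q a' e' = qShift β q (fun v => a' v + a (v + e')) (e' + e) := by
  simp only [qShift, shiftOp_mul, zpow_add₀ hq]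

variable {q} in
theorem smul_qShift (hq : q ≠ 0) (a : Expo n → ℤ) (e : Expo n) :
    q • qShift β q a e = qShift β q (fun v => a v + 1) e := by
  simp only [qShift, smul_shiftOp, zpow_add_one₀ hq, mul_comm q]

variable {q} in
theorem inv_smul_qShift (hq : q ≠ 0) (a : Expo n → ℤ) (e : Expo n) :
    q⁻¹ • qShift β q a e = qShift β q (fun v => a v - 1) e := by
  simp only [qShift, smul_shiftOp, zpow_sub_one₀ hq, mul_comm q⁻¹]

theorem qShift_congr {a a' : Expo n → ℤ} {e e' : Expo n} (ha : ∀ v, a v = a' v) (he : e = e') :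
    qShift β q a e = qShift β q a' e' := by
  rw [funext ha, he]

/-- The monomial with exponent the segment from `j` to `l` in the `p`-th group of variables. -/
noncomputable def segOp (p j l : ℕ) : Module.End k M :=
  qShift β q (fun v => (v.1 (p, l + 1) : ℤ) - v.1 (p, j)) (seg p j l, 0)

/-- An upper triangular quantum matrix: the identity in the rows above `p`, and of rank one
above the diagonal in the remaining rows. -/
noncomputable def cell (p j l : ℕ) : Module.End k M :=
  if j < p then (if j = l then 1 else 0) else if j ≤ l then segOp β q p j l else 0

theorem cell_of_lt (p : ℕ) {j l : ℕ} (h : l < j) : cell β q p j l = 0 := by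
  simp [cell, h.ne', h.not_ge]

theorem cell_of_lt_of_ne {p j l : ℕ} (h : j < p) (h' : j ≠ l) : cell β q p j l = 0 := by
  simp [cell, h, h']

theorem cell_self_of_lt {p j : ℕ} (h : j < p) : cell β q p j j = 1 := by
  simp [cell, h]

theorem cell_of_le {p j l : ℕ} (h : p ≤ j) (h' : j ≤ l) :
    cell β q p j l = segOp β q p j l := by
  simp [cell, h.not_gt, h']

variable {q}

/-- The two indicators are the changes of the exponents of `(p, l + 1)` and `(p, j)` caused by the
first shift; every relation below reduces to comparing them. -/
theorem segOp_mul_segOp (hq : q ≠ 0) (p p' j l j' l' : ℕ) :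
    segOp β q p j l * segOp β q p' j' l' =
      qShift β q (fun v => (v.1 (p', l' + 1) : ℤ) - v.1 (p', j') +
        (v.1 (p, l + 1) - v.1 (p, j)) +
        ((if p' = p ∧ j' ≤ l ∧ l < l' then 1 else 0) -
          if p' = p ∧ j' < j ∧ j ≤ l' then 1 else 0)) (seg p' j' l' + seg p j l, 0) := by
  rw [segOp, segOp, qShift_mul β hq]
  refine qShift_congr β q (fun v => ?_) (by simp)
  simp only [Prod.fst_add, Finsupp.add_apply, seg_apply, Nat.lt_succ_iff, Nat.succ_le_iff]
  push_cast
  ring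

theorem seg_add_seg {p j j' l l' : ℕ} (h : j ≤ l) (h1 : j ≤ l') (h2 : j' ≤ l) (h3 : j' ≤ l') :
    seg p j l + seg p j' l' = seg p j l' + seg p j' l := by
  ext ⟨p', b⟩
  simp only [Finsupp.add_apply, seg_apply]
  split_ifs <;> omega

/-- Entries in rows from `p` on are monomial shifts, so each relation is a comparison of powers of
`q`. In `diag` with all four entries nonzero, both products on the left have the exponent of `x i l
* x i' j` and are `q` and `q⁻¹` times it. -/
theorem isQMat_cell (hq : q ≠ 0) (p : ℕ) : IsQMat q (fun j l : ℕ => cell β q p j l) where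
  row i j l hj := by
    rcases lt_or_ge i p with hp | hp
    · rcases eq_or_ne i j with rfl | h
      · simp [cell_of_lt_of_ne β q hp hj.ne]
      · simp [cell_of_lt_of_ne β q hp h]
    rcases lt_or_ge j i with h | h
    · simp [cell_of_lt β q p h]
    rw [cell_of_le β q hp h, cell_of_le β q hp (h.trans hj.le), segOp_mul_segOp β hq,
      segOp_mul_segOp β hq, smul_qShift β hq]
    refine qShift_congr β q (fun v => ?_) (by rw [add_comm])
    split_ifs <;> omega
  col i i' j hi := by
    rcases lt_or_ge j i' with h | h
    · simp [cell_of_lt β q p h]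
    rcases lt_or_ge i p with hp | hp
    · simp [cell_of_lt_of_ne β q hp (hi.trans_le h).ne]
    rw [cell_of_le β q hp (hi.le.trans h), cell_of_le β q (hp.trans hi.le) h,
      segOp_mul_segOp β hq, segOp_mul_segOp β hq, smul_qShift β hq]
    refine qShift_congr β q (fun v => ?_) (by rw [add_comm])
    split_ifs <;> omega
  anti i i' j l hi hj := by
    rcases lt_or_ge j i' with h | h
    · simp [cell_of_lt β q p h]
    rcases lt_or_ge i p with hp | hp
    · simp [cell_of_lt_of_ne β q hp ((hi.trans_le h).trans hj).ne]
    rw [cell_of_le β q hp ((hi.le.trans h).trans hj.le), cell_of_le β q (hp.trans hi.le) h,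
      segOp_mul_segOp β hq, segOp_mul_segOp β hq]
    refine qShift_congr β q (fun v => ?_) (by rw [add_comm])
    split_ifs <;> omega
  diag i i' j l hi hj := by
    rcases lt_or_ge j i with h | h
    · simp [cell_of_lt β q p h, cell_of_lt β q p (h.trans hi)]
    rcases lt_or_ge i p with hp | hp
    · rcases eq_or_ne i j with rfl | hij
      · simp [cell_self_of_lt β q hp, cell_of_lt β q p hi]
      · simp [cell_of_lt_of_ne β q hp hij, cell_of_lt_of_ne β q hp (h.trans_lt hj).ne]
    rcases lt_or_ge l i' with h' | h'
    · simp [cell_of_lt β q p h', cell_of_lt β q p (hj.trans h')]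
    rw [cell_of_le β q hp h, cell_of_le β q (hp.trans hi.le) h']
    rcases lt_or_ge j i' with h'' | h''
    · rw [cell_of_lt β q p h'', mul_zero, smul_zero, sub_eq_zero, segOp_mul_segOp β hq,
        segOp_mul_segOp β hq]
      refine qShift_congr β q (fun v => ?_) (by rw [add_comm])
      split_ifs <;> omega
    · rw [cell_of_le β q hp (h.trans hj.le), cell_of_le β q (hp.trans hi.le) h'',
        segOp_mul_segOp β hq, segOp_mul_segOp β hq, segOp_mul_segOp β hq, sub_smul,
        smul_qShift β hq, inv_smul_qShift β hq]
      congr 1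
      · refine qShift_congr β q (fun v => ?_) ?_
        · split_ifs <;> omega
        · rw [seg_add_seg h' h'' (hi.le.trans h') h]
      · refine qShift_congr β q (fun v => ?_) ?_
        · split_ifs <;> omega
        · rw [add_comm, seg_add_seg h' h'' (hi.le.trans h') h]

theorem commute_cell (hq : q ≠ 0) {p p' : ℕ} (hp : p ≠ p') (j l j' l' : ℕ) :
    Commute (cell β q p j l) (cell β q p' j' l') := by
  have h : Commute (segOp β q p j l) (segOp β q p' j' l') := by
    rw [Commute, SemiconjBy, segOp_mul_segOp β hq, segOp_mul_segOp β hq]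
    refine qShift_congr β q (fun v => ?_) (by rw [add_comm])
    simp only [hp, hp.symm, false_and, if_false]
    ring
  unfold cell
  split_ifs <;> simp [h]

variable (q) in
/-- The diagonal matrix that records the multidegree. -/
noncomputable def recordOp (j l : Fin n) : Module.End k M :=
  if j = l then qShift β q (fun _ => 0) (0, Finsupp.single j 1) else 0

theorem commute_record (hq : q ≠ 0) (j l : Fin n) :
    Commute (qShift β q (fun _ => 0) (0, Finsupp.single j 1))
      (qShift β q (fun _ => 0) (0, Finsupp.single l 1)) := by
  rw [Commute, SemiconjBy, qShift_mul β hq, qShift_mul β hq]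
  exact qShift_congr β q (fun v => rfl) (by rw [add_comm])

theorem isQMat_recordOp (hq : q ≠ 0) : IsQMat q (recordOp β q) where
  row i j l hj := by
    rcases eq_or_ne i j with rfl | h
    · simp [recordOp, hj.ne]
    · simp [recordOp, h]
  col i i' j hi := by
    rcases eq_or_ne i j with rfl | h
    · simp [recordOp, hi.ne']
    · simp [recordOp, h]
  anti i i' j l hi hj := by
    rcases eq_or_ne i l with rfl | h
    · simp [recordOp, (hj.trans hi).ne']
    · simp [recordOp, h]
  diag i i' j l hi hj := by
    have h0 : recordOp β q i l * recordOp β q i' j = 0 := by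
      rcases eq_or_ne i l with rfl | h
      · simp [recordOp, (hj.trans hi).ne']
      · simp [recordOp, h]
    rw [h0, smul_zero, sub_eq_zero]
    unfold recordOp
    split_ifs
    · exact commute_record β hq _ _
    all_goals simp

theorem commute_cell_recordOp (hq : q ≠ 0) (p j l : ℕ) (a b : Fin n) :
    Commute (cell β q p j l) (recordOp β q a b) := by
  have h : Commute (segOp β q p j l)
      (qShift β q (fun _ => 0) (0, Finsupp.single a 1)) := by
    rw [Commute, SemiconjBy, segOp, qShift_mul β hq, qShift_mul β hq]
    exact qShift_congr β q (fun v => by simp) (by rw [add_comm])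
  unfold cell recordOp
  split_ifs <;> simp [h]

variable (q) in
/-- The product of the matrices `cell` for `p - 1, …, 0` and the diagonal matrix. -/
noncomputable def pathOp : ℕ → Fin n → Fin n → Module.End k M
  | 0 => recordOp β q
  | p + 1 => fun i j => ∑ l : Fin n, cell β q p i l * pathOp p l j

theorem pathOp_succ (p : ℕ) (i j : Fin n) :
    pathOp β q (p + 1) i j = ∑ l : Fin n, cell β q p i l * pathOp β q p l j := rfl

theorem commute_cell_pathOp (hq : q ≠ 0) {p p' : ℕ} (hp : p ≤ p') (j l : ℕ) (a b : Fin n) :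
    Commute (cell β q p' j l) (pathOp β q p a b) := by
  induction p generalizing a b with
  | zero => exact commute_cell_recordOp β hq _ _ _ _ _
  | succ p ih =>
    refine Commute.sum_right _ _ _ fun c _ => ?_
    exact (commute_cell β hq (by omega) _ _ _ _).mul_right (ih (by omega) _ _)

theorem isQMat_pathOp (hq : q ≠ 0) (p : ℕ) : IsQMat q (pathOp β q p) := by
  induction p with
  | zero => exact isQMat_recordOp β hq
  | succ p ih =>
    exact (IsRTT.mul (((isQMat_cell β hq p).comp Fin.val_strictMono Fin.val_strictMono).isRTT hq)
      (ih.isRTT hq) fun i j j' l => commute_cell_pathOp β hq le_rfl _ _ _ _).isQMat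

theorem pathOp_of_lt (p : ℕ) {i j : Fin n} (h : j < i) : pathOp β q p i j = 0 := by
  induction p generalizing i j with
  | zero => simp [pathOp, recordOp, h.ne']
  | succ p ih =>
    refine sum_eq_zero fun l _ => ?_
    rcases lt_or_ge j l with hl | hl
    · rw [ih hl, mul_zero]
    · rw [cell_of_lt β q p (hl.trans_lt h), zero_mul]

/-- The weight of an exponent: a variable `(p, b)` has weight `p`. -/
noncomputable def expoWeight (n : ℕ) : Expo n →+ ℤ :=
  (Finsupp.liftAddHom fun p : ℕ × ℕ =>
    ((AddMonoidHom.mulLeft (p.1 : ℤ)).comp (Nat.castAddMonoidHom ℤ))).comp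
    (AddMonoidHom.fst _ _)

theorem expoWeight_seg {p j l : ℕ} (h : j ≤ l) (d : Fin n →₀ ℕ) :
    expoWeight n (seg p j l, d) = p * ((l : ℤ) - j) := by
  simp [expoWeight, seg, map_sum, h, mul_comm]

/-- The leading exponent of the `(i, j)` entry. -/
noncomputable def leadExpo (i : ℕ) (j : Fin n) : Expo n := (seg i i j, Finsupp.single j 1)

theorem isLead_qShift (hq : q ≠ 0) (w : Expo n →+ ℤ) (a : Expo n → ℤ) (e : Expo n) :
    IsLead β w e (qShift β q a e) :=
  isLead_shiftOp (fun _ => zpow_ne_zero _ hq) e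

theorem raisesLE_cell (hq : q ≠ 0) {p i j : ℕ} (hi : p ≤ i) (hj : i ≤ j) :
    RaisesLE β (expoWeight n) (p * ((j : ℤ) - i)) (cell β q p i j) := by
  rw [cell_of_le β q hi hj, ← expoWeight_seg hj 0]
  exact (isLead_qShift β hq _ _ _).raisesLE

/-- An entry is a sum over paths `i ≤ … ≤ j`, where distance covered in group `p` has weight `p` per
unit. Row `i` is fixed by all groups above `i`, so the heaviest path covers the whole distance in
group `i`. The third clause bounds the paths restricted to groups below `p`: each unit of distance
loses at least one. -/
theorem pathOp_lead (hq : q ≠ 0) (p : ℕ) :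
    (∀ i j : Fin n, i.val < p → i ≤ j → IsLead β (expoWeight n) (leadExpo i j) (pathOp β q p i j)) ∧
    (∀ i : Fin n, p ≤ i.val → IsLead β (expoWeight n) (leadExpo i i) (pathOp β q p i i)) ∧
    ∀ i j : Fin n, p ≤ i.val → i < j →
      RaisesLE β (expoWeight n) (p * ((j : ℤ) - i) - 1) (pathOp β q p i j) := by
  induction p with
  | zero =>
    refine ⟨fun i j h => absurd h (by omega), fun i _ => ?_, fun i j _ hij => ?_⟩
    · simp only [pathOp, recordOp, if_true, leadExpo, seg, Ioc_self, sum_empty]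
      exact isLead_qShift β hq _ _ _
    · simp only [pathOp, recordOp, hij.ne, if_false]
      exact RaisesLE.zero _
  | succ p ih =>
    obtain ⟨ih1, ih2, ih3⟩ := ih
    refine ⟨fun i j hi hij => ?_, fun i hi => ?_, fun i j hi hij => ?_⟩
    · rcases Nat.lt_succ_iff_lt_or_eq.1 hi with hi | hi
      · have : pathOp β q (p + 1) i j = pathOp β q p i j := by
          rw [pathOp_succ, sum_eq_single i]
          · rw [cell_self_of_lt β q hi, one_mul]
          · intro l _ hl
            rw [cell_of_lt_of_ne β q hi (fun h => hl (Fin.ext h.symm)), zero_mul]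
          · simp
        rw [this]
        exact ih1 i j hi hij
      -- For the new row `i = p`, jumping straight to `j` in group `p` leads; stopping at `l < j`
      -- leaves a remainder covered by the third clause.
      · rw [pathOp_succ, ← add_sum_erase _ _ (mem_univ j)]
        have hpj : p ≤ j.val := hi ▸ hij
        have hlead : leadExpo i j = (seg p i j, 0) + leadExpo j j := by
          simp [leadExpo, seg, hi]
        refine IsLead.add ?_ (RaisesLE.sum fun l hl => ?_)
        · rw [hlead]
          refine IsLead.mul ?_ (ih2 j hpj)
          rw [cell_of_le β q hi.ge hij]
          exact isLead_qShift β hq _ _ _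
        · rw [leadExpo, expoWeight_seg hij]
          rcases lt_or_ge j l with h | h
          · rw [pathOp_of_lt β p h, mul_zero]
            exact RaisesLE.zero _
          have hlj : l < j := lt_of_le_of_ne h (mem_erase.1 hl).1
          rcases lt_or_ge l i with h' | h'
          · rw [cell_of_lt β q p h', zero_mul]
            exact RaisesLE.zero _
          · refine ((raisesLE_cell β hq hi.ge h').mul (ih3 l j (hi ▸ h') hlj)).mono (le_of_eq ?_)
            rw [hi]
            ring
    · rw [pathOp_succ, sum_eq_single i]
      · have hlead : leadExpo i i = (seg p i i, 0) + leadExpo i i := by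
          simp [leadExpo, seg]
        rw [hlead, cell_of_le β q (by omega) le_rfl]
        exact (isLead_qShift β hq _ _ _).mul (ih2 i (by omega))
      · intro l _ hl
        rcases lt_or_gt_of_ne hl with h | h
        · rw [cell_of_lt β q p h, zero_mul]
        · rw [pathOp_of_lt β p h, mul_zero]
      · simp
    · refine RaisesLE.sum fun l _ => ?_
      have hij' : (i : ℤ) < j := by exact_mod_cast hij
      rcases lt_or_ge l i with h | h
      · rw [cell_of_lt β q p h, zero_mul]
        exact RaisesLE.zero _
      have hc := raisesLE_cell β hq (p := p) (by omega) h
      rcases lt_trichotomy l j with h' | rfl | h'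
      · refine (hc.mul (ih3 l j (by have := Fin.le_def.1 h; omega) h')).mono ?_
        push_cast
        nlinarith
      · have h2 := (ih2 l (by have := Fin.le_def.1 h; omega)).raisesLE
        rw [leadExpo, expoWeight_seg le_rfl] at h2
        refine (hc.mul h2).mono ?_
        push_cast
        nlinarith
      · rw [pathOp_of_lt β p h', mul_zero]
        exact RaisesLE.zero _

end Model

theorem IsQMat.exists_algHom {k : Type*} [Field k] {q : k} {m n : ℕ} {A : Type*} [Ring A]
    [Algebra k A] {x : Fin m → Fin n → A} (h : IsQMat q x) :
    ∃ φ : QMatrix q m n →ₐ[k] A, ∀ i j, φ (X q i j) = x i j := by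
  have hrel : ∀ ⦃a b : FreeAlgebra k (Fin m × Fin n)⦄, MatrixRel q m n a b →
      FreeAlgebra.lift k (fun p : Fin m × Fin n => x p.1 p.2) a =
        FreeAlgebra.lift k (fun p : Fin m × Fin n => x p.1 p.2) b := by
    intro a b hab
    induction hab with
    | row i j l hj => simpa using h.row i j l hj
    | col i i' j hi => simpa using h.col i i' j hi
    | anti i i' j l hi hj => simpa using h.anti i i' j l hi hj
    | diag i i' j l hi hj => simpa using h.diag i i' j l hi hj
  refine ⟨RingQuot.liftAlgHom k ⟨FreeAlgebra.lift k fun p => x p.1 p.2, hrel⟩, fun i j => ?_⟩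
  refine (RingQuot.liftAlgHom_mkAlgHom_apply k _ hrel _).trans ?_
  simp

theorem perm_eq_one_of_monovary {m n : ℕ} (J : Fin m ↪o Fin n) {σ : Equiv.Perm (Fin m)}
    (h : Monovary (fun a : Fin m => (a : ℤ)) ((fun a : Fin m => ((J a : ℕ) : ℤ)) ∘ σ)) :
    σ = 1 := by
  have hmono : StrictMono σ.symm := by
    intro a b hab
    have h1 := @h (σ.symm a) (σ.symm b) (by simpa using hab)
    simp only [Nat.cast_le, Fin.val_fin_le] at h1
    exact lt_of_le_of_ne h1 (σ.symm.injective.ne hab.ne)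
  have h1 : hmono.orderIsoOfSurjective _ σ.symm.surjective = OrderIso.refl _ :=
    Subsingleton.elim _ _
  ext a
  have h2 := DFunLike.congr_fun h1 (σ a)
  simp at h2
  simp [← h2]

/-- The strict rearrangement inequality, applied to the weights of the monomials of a maximal minor:
the diagonal one is the unique heaviest. -/
theorem sum_mul_perm_lt {m n : ℕ} (J : Fin m ↪o Fin n) {σ : Equiv.Perm (Fin m)} (hσ : σ ≠ 1) :
    ∑ a : Fin m, (a : ℤ) * ((J (σ a) : ℕ) - (a : ℕ) : ℤ) <
      ∑ a : Fin m, (a : ℤ) * ((J a : ℕ) - (a : ℕ) : ℤ) := by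
  simp only [mul_sub, sum_sub_distrib]
  have hJ : Monovary (fun a : Fin m => (a : ℤ)) (fun a : Fin m => ((J a : ℕ) : ℤ)) := by
    intro a b hab
    simp only [Nat.cast_lt, Fin.val_fin_lt, OrderEmbedding.lt_iff_lt] at hab
    simpa using hab.le
  have := (hJ.sum_mul_comp_perm_lt_sum_mul_iff (σ := σ)).2
    fun h => hσ (perm_eq_one_of_monovary J h)
  linarith

theorem val_le_of_orderEmb {m n : ℕ} (J : Fin m ↪o Fin n) (a : Fin m) : (a : ℕ) ≤ J a := by
  obtain ⟨a, ha⟩ := a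
  induction a with
  | zero => exact Nat.zero_le _
  | succ a ih =>
    have h1 := ih (by omega)
    have h2 : J ⟨a, by omega⟩ < J ⟨a + 1, ha⟩ := J.strictMono (by simp)
    have h3 := Fin.lt_def.1 h2
    simp only at h1 ⊢
    omega

/-! ### Leading exponents determine preferred tableaux -/

section Expo

variable {m n : ℕ}

/-- The leading exponent of the maximal minor `[J]`. -/
noncomputable def rowExpo (J : Fin m ↪o Fin n) : Expo n :=
  ((List.finRange m).map fun a : Fin m => leadExpo (a : ℕ) (J a)).sum

/-- The leading exponent of the product `[T]`. -/
noncomputable def tableauExpo (T : Tableau m n) : Expo n := (T.map rowExpo).sum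

theorem sum_finRange {α : Type*} [AddCommMonoid α] (f : Fin m → α) :
    ((List.finRange m).map f).sum = ∑ a, f a := by
  rw [← List.ofFn_eq_map, List.sum_ofFn]

theorem expoWeight_rowExpo (J : Fin m ↪o Fin n) :
    expoWeight n (rowExpo J) = ∑ a : Fin m, (a : ℤ) * ((J a : ℕ) - (a : ℕ) : ℤ) := by
  rw [rowExpo, sum_finRange, map_sum]
  refine sum_congr rfl fun a _ => ?_
  rw [leadExpo, expoWeight_seg (val_le_of_orderEmb J a)]

theorem rowExpo_fst (J : Fin m ↪o Fin n) (i : Fin m) {b : ℕ} (hb : (i : ℕ) < b) :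
    (rowExpo J).1 ((i : ℕ), b) = if b ≤ J i then 1 else 0 := by
  rw [rowExpo, sum_finRange, Prod.fst_sum, Finsupp.finsetSum_apply, sum_eq_single i]
  · simp [leadExpo, seg_apply, hb]
  · intro a _ ha
    have : (a : ℕ) ≠ i := fun h => ha (Fin.ext h)
    simp [leadExpo, seg_apply, this]
  · simp

theorem degree_rowExpo (J : Fin m ↪o Fin n) : (rowExpo J).2.degree = m := by
  rw [rowExpo, sum_finRange, Prod.snd_sum, map_sum]
  simp [leadExpo]

theorem degree_tableauExpo (T : Tableau m n) : (tableauExpo T).2.degree = T.length * m := by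
  induction T with
  | nil => simp [tableauExpo]
  | cons J T ih =>
    rw [tableauExpo, List.map_cons, List.sum_cons, Prod.snd_add, map_add, degree_rowExpo]
    rw [tableauExpo] at ih
    rw [ih, List.length_cons]
    ring

theorem tableauExpo_fst (T : Tableau m n) (i : Fin m) {b : ℕ} (hb : (i : ℕ) < b) :
    (tableauExpo T).1 ((i : ℕ), b) = (T.map fun J => (J i : ℕ)).countP (b ≤ ·) := by
  induction T with
  | nil => simp [tableauExpo]
  | cons J T ih =>
    rw [tableauExpo, List.map_cons, List.sum_cons, Prod.fst_add, Finsupp.add_apply,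
      rowExpo_fst J i hb]
    rw [tableauExpo] at ih
    rw [ih, List.map_cons, List.countP_cons, add_comm]
    simp

theorem count_add_countP (l : List ℕ) (a : ℕ) :
    l.count a + l.countP (a + 1 ≤ ·) = l.countP (a ≤ ·) := by
  induction l with
  | nil => rfl
  | cons b l ih =>
    simp only [List.count_cons, List.countP_cons, ← ih]
    rcases lt_trichotomy a b with h | rfl | h
    · simp [h.ne', h.le, Nat.succ_le_of_lt h]; omega
    · simp; omega
    · simp [h.ne, h.not_ge]; omega

theorem eq_of_countP_eq {l l' : List ℕ} (hl : l.Pairwise (· ≤ ·)) (hl' : l'.Pairwise (· ≤ ·))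
    (h : ∀ b, l.countP (b ≤ ·) = l'.countP (b ≤ ·)) : l = l' := by
  refine List.Perm.eq_of_pairwise (le := (· ≤ ·)) (fun a b _ _ => le_antisymm) hl hl' ?_
  rw [List.perm_iff_count]
  intro a
  have h1 := count_add_countP l a
  have h2 := count_add_countP l' a
  rw [h a, h (a + 1)] at h1
  omega

theorem Tableau.Preferred.pairwise {T : Tableau m n} (hT : T.Preferred) (i : Fin m) :
    (T.map fun J => (J i : ℕ)).Pairwise (· ≤ ·) := by
  have : IsTrans (Fin m ↪o Fin n) StarLE := ⟨fun A B C h h' a => (h a).trans (h' a)⟩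
  rw [List.pairwise_map]
  exact (List.isChain_iff_pairwise.1 hT).imp fun {A B} h => h i

/-- The total multidegree gives the number of rows, and the exponent of `(i, b)` with `b > i` counts
the rows whose `i`-th entry is at least `b`. These numbers fix each column as a multiset, and
columns of a preferred tableau are sorted. -/
theorem tableauExpo_injective (hm : 0 < m) :
    Function.Injective fun T : {T : Tableau m n // T.Preferred} => tableauExpo T.1 := by
  rintro ⟨T, hT⟩ ⟨T', hT'⟩ h
  simp only at h
  have hlen : T.length = T'.length := by
    have := congrArg (fun v : Expo n => v.2.degree) h
    simp only [degree_tableauExpo] at this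
    exact Nat.eq_of_mul_eq_mul_right hm this
  have hcol : ∀ i : Fin m, (T.map fun J => (J i : ℕ)) = T'.map fun J => (J i : ℕ) := by
    intro i
    refine eq_of_countP_eq (hT.pairwise i) (hT'.pairwise i) fun b => ?_
    rcases lt_or_ge (i : ℕ) b with hb | hb
    · rw [← tableauExpo_fst T i hb, ← tableauExpo_fst T' i hb, h]
    -- For `b ≤ i` the exponent carries no information, but every `i`-th entry is at least `i`, so
    -- all rows count.
    · have : ∀ T : Tableau m n, (T.map fun J => (J i : ℕ)).countP (b ≤ ·) = T.length := by
        intro T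
        rw [← List.length_map (as := T) (fun J => (J i : ℕ)), List.countP_eq_length]
        intro a ha
        obtain ⟨J, _, rfl⟩ := List.mem_map.1 ha
        simpa using hb.trans (val_le_of_orderEmb J i)
      rw [this, this, hlen]
  refine Subtype.ext (List.ext_getElem hlen fun r h1 h2 => ?_)
  refine DFunLike.ext _ _ fun i => Fin.ext ?_
  have := congrArg (fun l => l[r]?) (hcol i)
  simpa [h1, h2] using this

end Expo

/-! ### Leading terms of minors and multidegrees in the model -/

section Representation

variable {k : Type*} [Field k] {q : k} {m n : ℕ} {M : Type*} [AddCommGroup M] [Module k M]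
  {β : Module.Basis (Expo n) k M} {φ : QMatrix q m n →ₐ[k] Module.End k M} {hmn : m ≤ n}

theorem isLead_maxMinor (hq : q ≠ 0)
    (hφ : ∀ i j, φ (X q i j) = pathOp β q m (Fin.castLE hmn i) j) (J : Fin m ↪o Fin n) :
    IsLead β (expoWeight n) (rowExpo J) (φ (maxMinor q J)) := by
  obtain ⟨h1, -, -⟩ := pathOp_lead β hq m
  have hX : ∀ (i : Fin m) (j : Fin n), RaisesLE β (expoWeight n)
      ((i : ℤ) * ((j : ℕ) - (i : ℕ) : ℤ)) (φ (X q i j)) := by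
    intro i j
    rw [hφ]
    rcases lt_or_ge j (Fin.castLE hmn i) with h | h
    · rw [pathOp_of_lt β m h]
      exact RaisesLE.zero _
    · have := (h1 (Fin.castLE hmn i) j i.2 h).raisesLE
      rwa [leadExpo, expoWeight_seg h] at this
  have hsum : φ (maxMinor q J) = ∑ σ : Equiv.Perm (Fin m), (-q) ^ invCount σ •
      ((List.finRange m).map fun a => φ (X q a (J (σ a)))).prod := by
    rw [maxMinor, quantumMinor, map_sum]
    refine sum_congr rfl fun σ _ => ?_
    rw [map_smul, map_list_prod, List.ofFn_eq_map, List.map_map]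
    rfl
  rw [hsum, ← add_sum_erase _ _ (mem_univ 1)]
  have hinv : invCount (1 : Equiv.Perm (Fin m)) = 0 := by
    rw [invCount, card_eq_zero, filter_eq_empty_iff]
    rintro ⟨a, b⟩ - ⟨h, h'⟩
    exact absurd h h'.not_gt
  refine IsLead.add ?_ (RaisesLE.sum fun σ hσ => ?_)
  · rw [hinv, pow_zero, one_smul]
    refine IsLead.list_prod fun a _ => ?_
    rw [hφ]
    exact h1 (Fin.castLE hmn a) (J a) a.2 (val_le_of_orderEmb J a)
  · refine RaisesLE.smul (RaisesLE.mono (RaisesLE.list_prod fun a _ => hX a (J (σ a))) ?_) _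
    rw [sum_finRange, expoWeight_rowExpo]
    exact Int.le_sub_one_of_lt (sum_mul_perm_lt J (mem_erase.1 hσ).1)

theorem isLead_tableauProduct (hq : q ≠ 0)
    (hφ : ∀ i j, φ (X q i j) = pathOp β q m (Fin.castLE hmn i) j) (T : Tableau m n) :
    IsLead β (expoWeight n) (tableauExpo T) (φ (tableauProduct q T)) := by
  rw [coe_tableauProduct, map_list_prod, List.map_map]
  exact IsLead.list_prod fun J _ => isLead_maxMinor hq hφ J

variable (β) in
/-- The span of the basis vectors of multidegree `d`. -/
def degreeSpan (d : Fin n → ℤ) : Submodule k M :=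
  Submodule.span k (β '' {v | ∀ j, (v.2 j : ℤ) = d j})

theorem shiftOp_mem_degreeSpan (c : Expo n → k) (e : Expo n) {d : Fin n → ℤ} {f : M}
    (hf : f ∈ degreeSpan β d) :
    shiftOp β c e f ∈ degreeSpan β (fun j => d j + e.2 j) := by
  have h : degreeSpan β d ≤ (degreeSpan β fun j => d j + e.2 j).comap (shiftOp β c e) := by
    refine Submodule.span_le.2 ?_
    rintro _ ⟨v, hv, rfl⟩
    rw [SetLike.mem_coe, Submodule.mem_comap, shiftOp_basis]
    refine Submodule.smul_mem _ _ (Submodule.subset_span ⟨v + e, fun j => ?_, rfl⟩)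
    have := hv j
    simp [this]
  exact h hf

theorem cell_mem_degreeSpan (p i j : ℕ) {d : Fin n → ℤ} {f : M} (hf : f ∈ degreeSpan β d) :
    cell β q p i j f ∈ degreeSpan β d := by
  unfold cell
  split_ifs
  · exact hf
  · exact Submodule.zero_mem _
  · have h := shiftOp_mem_degreeSpan (fun v => q ^ ((v.1 (p, j + 1) : ℤ) - v.1 (p, i)))
      (seg p i j, 0) hf
    simp only [Finsupp.coe_zero, Pi.zero_apply, Nat.cast_zero, add_zero] at h
    exact h
  · exact Submodule.zero_mem _

/-- Only the diagonal matrix touches the recorded multidegree, and being the last factor it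
contributes exactly the column `j`. -/
theorem pathOp_mem_degreeSpan (p : ℕ) (i j : Fin n) {d : Fin n → ℤ} {f : M}
    (hf : f ∈ degreeSpan β d) :
    pathOp β q p i j f ∈ degreeSpan β (Pi.single j 1 + d) := by
  induction p generalizing i with
  | zero =>
    unfold pathOp recordOp
    split_ifs with h
    · have h1 := shiftOp_mem_degreeSpan (fun _ => q ^ (0 : ℤ)) (0, Finsupp.single i 1) hf
      have h2 : (fun l => d l + ((Finsupp.single i 1 : Fin n →₀ ℕ) l : ℤ)) =
          Pi.single j 1 + d := by
        ext l
        rw [Pi.add_apply, add_comm, Pi.single_apply, Finsupp.single_apply, h]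
        simp [eq_comm]
      rw [← h2]
      exact h1
    · exact Submodule.zero_mem _
  | succ p ih =>
    rw [pathOp_succ, LinearMap.sum_apply]
    exact Submodule.sum_mem _ fun l _ => cell_mem_degreeSpan _ _ _ (ih l)

theorem apply_word_mem_degreeSpan
    (hφ : ∀ i j, φ (X q i j) = pathOp β q m (Fin.castLE hmn i) j) (u : List (Fin m × Fin n)) :
    φ (u.map fun p => X q p.1 p.2).prod (β 0) ∈ degreeSpan β (wordDegree u) := by
  induction u with
  | nil =>
    rw [List.map_nil, List.prod_nil, map_one]
    exact Submodule.subset_span ⟨0, by simp [wordDegree], rfl⟩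
  | cons p u ih =>
    rw [List.map_cons, List.prod_cons, map_mul, hφ, Module.End.mul_apply]
    exact pathOp_mem_degreeSpan _ _ _ ih

theorem apply_mem_degreeSpan
    (hφ : ∀ i j, φ (X q i j) = pathOp β q m (Fin.castLE hmn i) j) {d : Fin n → ℤ}
    {y : QMatrix q m n} (hy : y ∈ matrixComponent q m n d) :
    φ y (β 0) ∈ degreeSpan β d := by
  have h : matrixComponent q m n d ≤ (degreeSpan β d).comap
      ((LinearMap.applyₗ (β 0)).comp φ.toLinearMap) := by
    refine Submodule.span_le.2 ?_
    rintro _ ⟨u, rfl, rfl⟩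
    exact apply_word_mem_degreeSpan hφ u
  exact h hy

variable (β) in
/-- The projection onto the span of the basis vectors of multidegree `d`. -/
noncomputable def degreeProj (d : Fin n → ℤ) : M →ₗ[k] M :=
  open scoped Classical in
  β.constr k fun v => if ∀ j, (v.2 j : ℤ) = d j then β v else 0

theorem degreeProj_apply_of_mem {d : Fin n → ℤ} {f : M} (hf : f ∈ degreeSpan β d) :
    degreeProj β d f = f := by
  induction hf using Submodule.span_induction with
  | mem f hf =>
    obtain ⟨v, hv, rfl⟩ := hf
    rw [degreeProj, β.constr_basis]
    exact if_pos hv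
  | zero => simp
  | add f g _ _ hf hg => rw [map_add, hf, hg]
  | smul c f _ hf => rw [map_smul, hf]

theorem degreeProj_apply_of_ne {d d' : Fin n → ℤ} (hd : d' ≠ d) {f : M}
    (hf : f ∈ degreeSpan β d') : degreeProj β d f = 0 := by
  induction hf using Submodule.span_induction with
  | mem f hf =>
    obtain ⟨v, hv, rfl⟩ := hf
    rw [degreeProj, β.constr_basis, if_neg]
    exact fun h => hd (funext fun j => (hv j).symm.trans (h j))
  | zero => simp
  | add f g _ _ hf hg => rw [map_add, hf, hg, add_zero]
  | smul c f _ hf => rw [map_smul, hf, smul_zero]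

end Representation

/-! ### Homogeneous components -/

section Component

variable {k : Type*} [Field k] {q : k} {m n : ℕ}

theorem wordDegree_append (u v : List (Fin m × Fin n)) :
    wordDegree (u ++ v) = wordDegree u + wordDegree v := by
  simp [wordDegree]

theorem mul_mem_matrixComponent {d d' : Fin n → ℤ} {y z : QMatrix q m n}
    (hy : y ∈ matrixComponent q m n d) (hz : z ∈ matrixComponent q m n d') :
    y * z ∈ matrixComponent q m n (d + d') := by
  have h := Submodule.mul_mem_mul hy hz
  rw [matrixComponent, matrixComponent, Submodule.span_mul_span] at h
  refine Submodule.span_mono ?_ h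
  rintro _ ⟨_, ⟨u, hu, rfl⟩, _, ⟨v, hv, rfl⟩, rfl⟩
  refine ⟨u ++ v, ?_, by simp⟩
  exact (wordDegree_append u v).trans (congrArg₂ (· + ·) hu hv)

theorem maxMinor_mem_matrixComponent (J : Fin m ↪o Fin n) :
    maxMinor q J ∈ matrixComponent q m n
      (fun j => (((univ : Finset (Fin m)).val.map J).count j : ℤ)) := by
  refine Submodule.sum_mem _ fun σ _ => Submodule.smul_mem _ _ (Submodule.subset_span ?_)
  refine ⟨List.ofFn fun a => (a, J (σ a)), ?_, ?_⟩
  · change wordDegree _ = _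
    rw [wordDegree, List.map_ofFn, List.sum_ofFn]
    simp only [Function.comp_apply]
    rw [Equiv.sum_comp σ (fun a => (Pi.single (J a) 1 : Fin n → ℤ))]
    ext j
    rw [Finset.sum_apply, Multiset.count_map, ← Finset.filter_val, Finset.card_val, card_filter]
    push_cast
    exact sum_congr rfl fun a _ => by simp [Pi.single_apply]
  · simp only [List.map_ofFn]
    rfl

theorem tableauProduct_mem_component (T : Tableau m n) :
    (tableauProduct q T : QMatrix q m n) ∈
      matrixComponent q m n (fun j => (T.content.count j : ℤ)) := by
  rw [coe_tableauProduct]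
  induction T with
  | nil => exact Submodule.subset_span ⟨[], by ext j; simp [wordDegree, Tableau.content], by simp⟩
  | cons J T ih =>
    rw [List.map_cons, List.prod_cons]
    convert mul_mem_matrixComponent (maxMinor_mem_matrixComponent J) ih using 2
    ext j
    simp [Tableau.content]

theorem count_multisetOf (c : Fin n → ℕ) (j : Fin n) : (multisetOf c).count j = c j := by
  simp [multisetOf, Multiset.count_sum', Multiset.count_replicate]

theorem count_content_eq_iff (T : Tableau m n) (c : Fin n → ℕ) :
    ((fun j => (T.content.count j : ℤ)) = fun j => (c j : ℤ)) ↔ T.content = multisetOf c := by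
  rw [Multiset.ext]
  simp only [count_multisetOf, funext_iff, Nat.cast_inj]

/-- A linear map on the quantum grassmannian under which the products of preferred
tableaux stay linearly independent, and a compatible family of projections. -/
theorem exists_separating (hq : q ≠ 0) (hm : 0 < m) (hmn : m ≤ n) :
    ∃ (ψ : grassmannian q m n →ₗ[k] (Expo n →₀ k))
      (π : (Fin n → ℤ) → (Expo n →₀ k) →ₗ[k] (Expo n →₀ k)),
      (LinearIndependent k fun T : {T : Tableau m n // T.Preferred} =>
        ψ (tableauProduct q T.1)) ∧
      (∀ d, ∀ y ∈ grassmannianComponent q m n d, π d (ψ y) = ψ y) ∧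
      ∀ d d', d' ≠ d → ∀ y ∈ grassmannianComponent q m n d', π d (ψ y) = 0 := by
  let β : Module.Basis (Expo n) k (Expo n →₀ k) := Finsupp.basisSingleOne
  obtain ⟨φ, hφ⟩ := ((isQMat_pathOp β hq m).comp (f := Fin.castLE hmn) (g := id)
    (Fin.strictMono_castLE hmn) strictMono_id).exists_algHom
  refine ⟨(LinearMap.applyₗ (β 0)).comp
    (φ.toLinearMap.comp (grassmannian q m n).val.toLinearMap), degreeProj β, ?_, ?_, ?_⟩
  · exact linearIndependent_of_isLead (tableauExpo_injective hm)
      fun T => isLead_tableauProduct hq hφ T.1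
  · exact fun d y hy => degreeProj_apply_of_mem (apply_mem_degreeSpan hφ hy)
  · exact fun d d' hd y hy => degreeProj_apply_of_ne hd (apply_mem_degreeSpan hφ hy)

end Component

end QuantumGrassmannian

/-! ### Assembly of the two bases -/

open QuantumGrassmannian in
theorem mainTheorem2 {k : Type*} [Field k] (q : k) (hq : q ≠ 0)
    (m n : ℕ) (hm : 0 < m) (hmn : m ≤ n) :
    (∀ c : Fin n → ℕ,
      ∃ b : Module.Basis
          {T : QuantumGrassmannian.Tableau m n //
            T.Preferred ∧ T.content = QuantumGrassmannian.multisetOf c}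
          k (QuantumGrassmannian.grassmannianComponent q m n fun j => (c j : ℤ)),
        ∀ T, (b T : QuantumGrassmannian.grassmannian q m n) =
          QuantumGrassmannian.tableauProduct q T.1) ∧
    ∃ b : Module.Basis {T : QuantumGrassmannian.Tableau m n // T.Preferred}
        k (QuantumGrassmannian.grassmannian q m n),
      ∀ T, b T = QuantumGrassmannian.tableauProduct q T.1 := by
  obtain ⟨ψ, π, hψ, hπ, hπ'⟩ := exists_separating hq hm hmn
  have hli : LinearIndependent k fun T : {T : Tableau m n // T.Preferred} =>
      tableauProduct q T.1 := LinearIndependent.of_comp ψ hψ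
  let b := Module.Basis.mk hli (span_tableauProduct hq).ge
  have hb : ∀ T, b T = tableauProduct q T.1 := fun T => Module.Basis.mk_apply _ _ T
  refine ⟨fun c => ?_, b, hb⟩
  set V := grassmannianComponent q m n fun j => (c j : ℤ) with hV
  have hmem : ∀ T : {T : Tableau m n // T.Preferred ∧ T.content = multisetOf c},
      tableauProduct q T.1 ∈ V := by
    intro T
    have h := tableauProduct_mem_component (q := q) T.1
    rw [(count_content_eq_iff T.1 c).2 T.2.2] at h
    exact h
  let v : {T : Tableau m n // T.Preferred ∧ T.content = multisetOf c} → V :=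
    fun T => ⟨tableauProduct q T.1, hmem T⟩
  have hv : LinearIndependent k v := by
    refine LinearIndependent.of_comp V.subtype ?_
    exact hli.comp (fun T : {T : Tableau m n // T.Preferred ∧ T.content = multisetOf c} =>
      (⟨T.1, T.2.1⟩ : {T : Tableau m n // T.Preferred}))
      fun T T' h => Subtype.ext (congrArg (fun S => S.1) h)
  have hψinj : Function.Injective ψ := by
    rw [injective_iff_map_eq_zero]
    intro y hy
    rw [← b.linearCombination_repr y, Finsupp.apply_linearCombination] at hy
    have hcomp : ψ ∘ b = fun T => ψ (tableauProduct q T.1) := funext fun T => by simp [hb]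
    rw [hcomp] at hy
    exact b.repr.map_eq_zero_iff.1 (linearIndependent_iff.1 hψ _ hy)
  have hspan : ⊤ ≤ Submodule.span k (Set.range v) := by
    rintro ⟨y, hy⟩ -
    have key : y ∈ (Submodule.span k (Set.range v)).map V.subtype := by
      -- Projecting the expansion of `y` to degree `c` in the model fixes `ψ y` and kills the
      -- tableaux of other content; injectivity of `ψ` brings the identity back to `y`.
      have hy1 : ψ y = ψ (∑ T ∈ (b.repr y).support with T.1.content = multisetOf c,
          b.repr y T • b T) := by
        conv_lhs => rw [← hπ _ y hy, ← b.linearCombination_repr y]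
        rw [Finsupp.linearCombination_apply, Finsupp.sum, map_sum, map_sum, map_sum,
          Finset.sum_filter]
        refine Finset.sum_congr rfl fun T _ => ?_
        rw [map_smul, map_smul, hb]
        split_ifs with h
        · rw [hπ _ _ (hmem ⟨T.1, T.2, h⟩)]
        · rw [hπ' _ _ (fun h' => h ((count_content_eq_iff T.1 c).1 h')) _
            (tableauProduct_mem_component T.1), smul_zero]
      rw [hψinj hy1]
      refine Submodule.sum_mem _ fun T hT => Submodule.smul_mem _ _ ?_
      rw [hb]
      exact ⟨v ⟨T.1, T.2, (Finset.mem_filter.1 hT).2⟩, Submodule.subset_span ⟨_, rfl⟩, rfl⟩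
    obtain ⟨z, hz, hzy⟩ := key
    exact (Subtype.ext hzy : z = ⟨y, hy⟩) ▸ hz
  exact ⟨Module.Basis.mk hv hspan, fun T => by rw [Module.Basis.mk_apply]⟩
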